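/- Consider $N$ agents and a horizon $T$. The state $x_t\in\mathbb R^m$ evolves by $x_{t+1}=A_tx_t+\sum_{i=1}^N B^i_tu^i_t+\omega_t$, $0\le t\le T-1$, where the noises $\omega_t\sim\mathcal N(0,\Sigma)$, $\Sigma\succeq0$, are independent of each other and of the past. A policy $\pi^i$ of agent $i$ consists of probability kernels $\pi^i_t$ that map the agent's information $(x_0,u^i_0,x_1,\dots,u^i_{t-1},x_t)$ to a law on $\mathbb R^p$; the agents draw their actions $u^i_t\sim\pi^i_t$ independently of each other. For symmetric $Q^i_t\succeq0$, $R^i_t\succ0$ and $\tau>0$, agent $i$ has the cost-to-go $$J^i_t(h,\pi)=\mathbb E\Big[\sum_{s=t}^{T-1}\big(x_s^\top Q^i_sx_s+(u^i_s)^\top R^i_su^i_s+\tau\,\mathrm{KL}(\pi^i_s\,\|\,\mathcal N(0,I))\big)+x_T^\top Q^i_Tx_T\,\Big|\,h\Big]\in[0,\infty]$$ given a history $h=(x_0,u_0,\dots,u_{t-1},x_t)$ up to time $t$ (with $u_s=(u^1_s,\dots,u^N_s)$), and the cost $J^i(x,\pi)=J^i_0(x,\pi)$. A profile $\pi$ is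 a Nash equilibrium (NE) if $J^i(x,\pi)\le J^i(x,(\sigma,\pi^{-i}))$ for all $x\in\mathbb R^m$, all $i$ and all policies $\sigma$ of agent $i$. It is a feedback NE if $J^i_t(h,\pi)<\infty$ and $J^i_t(h,\pi)\le J^i_t(h,(\sigma,\pi^{-i}))$ for all $i$, all $0\le t\le T$, all histories $h$ up to time $t$ and all policies $\sigma$ of agent $i$. It is linear Gaussian if $\pi^i_t=\mathcal N(K^i_tx_t,S^i_t)$ with matrices $K^i_t$ and $S^i_t\succ0$. The coupled Nash Riccati equations on $\{t_0,\dots,T\}$ are $P^{i}_T=Q^i_T$ and, for $t_0\le t\le T-1$ and all $i$, $$K^{i}_t=-\big(\tfrac\tau2I+R^i_t+(B^i_t)^\top P^{i}_{t+1}B^i_t\big)^{-1}(B^i_t)^\top P^{i}_{t+1}A^{i}_t,\qquad A^{i}_t=A_t+\sum_{j\ne i}B^j_tK^{j}_t,$$ $$P^{i}_t=Q^i_t+(A^{i}_t)^\top P^{i}_{t+1}A^{i}_t-\big((B^i_t)^\top P^{i}_{t+1}A^{i}_t\big)^\top\big(\tfrac\tau2I+R^i_t+(B^i_t)^\top P^{i}_{t+1}B^i_t\big)^{-1}(B^i_t)^\top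 P^{i}_{t+1}A^{i}_t .$$ Let $\gamma_B$ and $\gamma^*_P$ be numbers such that $\|B^i_t\|_F\le\gamma_B$ for all $i,t$, and $\|P^{i}_t\|_F\le\gamma^*_P$ for all $i$ and all $t_0\le t\le T$ whenever $(P,K)$ solves the coupled Nash Riccati equations on $\{t_0,\dots,T\}$ for some $0\le t_0\le T$. Assume $\tau>2\gamma_B^2\gamma^*_P(N-1)$. Then the game has exactly one feedback NE $\pi^*$. It is linear Gaussian and it is an NE. Moreover it is the only linear Gaussian NE up to the behaviour at states that are not visited: if $\pi$ is any linear Gaussian NE, then for every initial state $x$, almost surely along the trajectory generated by $\pi$ from $x$, the action laws prescribed by $\pi$ and by $\pi^*$ coincide for all agents and all times. -/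

import Mathlib

open MeasureTheory ProbabilityTheory
open scoped ENNReal Matrix Matrix.Norms.Frobenius

noncomputable section

/-- The data of an entropy-regularized general-sum linear-quadratic game with `N` agents, state
space `ℝᵐ`, action spaces `ℝᵖ` and horizon `T`. -/
structure LQGame (N m p T : ℕ) where
  A : Fin T → Matrix (Fin m) (Fin m) ℝ
  B : Fin N → Fin T → Matrix (Fin m) (Fin p) ℝ
  Q : Fin N → Fin (T + 1) → Matrix (Fin m) (Fin m) ℝ
  R : Fin N → Fin T → Matrix (Fin p) (Fin p) ℝ
  /-- covariance of the state noise -/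
  W : Matrix (Fin m) (Fin m) ℝ
  /-- entropy regularization parameter -/
  τ : ℝ
  Q_posSemidef : ∀ i t, (Q i t).PosSemidef
  R_posDef : ∀ i t, (R i t).PosDef
  W_posSemidef : W.PosSemidef
  τ_pos : 0 < τ

/-- State space. -/
abbrev State (m : ℕ) := EuclideanSpace ℝ (Fin m)

/-- Action space of one agent. -/
abbrev Act (p : ℕ) := EuclideanSpace ℝ (Fin p)

/-- Trajectories: the states `x_0, …, x_T` and the actions `u_0, …, u_{T-1}` of all agents. -/
structure Traj (N m p T : ℕ) where
  x : Fin (T + 1) → State m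
  u : Fin T → Fin N → Act p

/-- Values of the information of one agent at time `t`: the states `x_0, …, x_t` and the agent's
own actions `u_0, …, u_{t-1}`. -/
abbrev Info (m p T : ℕ) (t : Fin T) :=
  ({s : Fin (T + 1) // s ≤ t.castSucc} → State m) × ({s : Fin T // s < t} → Act p)

/-- A randomized policy of one agent: for every time, a (measurable) probability kernel from the
agent's information to actions. -/
structure Policy (m p T : ℕ) where
  kernel : ∀ t : Fin T, Kernel (Info m p T t) (Act p)
  isMarkov : ∀ t, IsMarkovKernel (kernel t)

/-- Policy profiles. -/
abbrev Profile (N m p T : ℕ) := Fin N → Policy m p T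

variable {N m p T : ℕ}

/-- The information of agent `i` at time `t` along a trajectory. -/
def Traj.info (ω : Traj N m p T) (i : Fin N) (t : Fin T) : Info m p T t :=
  (fun s => ω.x s.1, fun s => ω.u s.1 i)

/-- The trajectory `ω` with the time-`t` actions and the time-`t+1` state overwritten. -/
def Traj.extend (ω : Traj N m p T) (t : Fin T) (a : Fin N → Act p) (y : State m) :
    Traj N m p T :=
  ⟨Function.update ω.x t.succ y, Function.update ω.u t a⟩

/-- A trajectory that starts in `x₀` (the other entries are placeholders that get overwritten). -/
def Traj.start (x₀ : State m) : Traj N m p T := ⟨fun _ => x₀, fun _ _ => 0⟩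

/-- The law of the action of agent `i` at time `t`, given its information along `ω`. -/
def Profile.actionLaw (π : Profile N m p T) (i : Fin N) (t : Fin T) (ω : Traj N m p T) :
    Measure (Act p) :=
  (π i).kernel t (ω.info i t)

namespace LQGame

variable (G : LQGame N m p T)

/-- The next state `A_t x_t + ∑ i, B^i_t u^i_t + w`. -/
def next (t : Fin T) (ω : Traj N m p T) (a : Fin N → Act p) (w : State m) : State m :=
  (G.A t).toEuclideanLin (ω.x t.castSucc) + ∑ i, (G.B i t).toEuclideanLin (a i) + w

/-- `G.expect π F t ω` is the conditional expectation, under the profile `π`, of a nonnegative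
functional `F` of the trajectory, given that the trajectory up to time `t` (that is, `x_0, …, x_t`
and `u_0, …, u_{t-1}`) is that of `ω`: from time `t` on the agents draw their actions independently
of each other from `π`, and the noise is drawn independently from `N(0, W)`. -/
def expect (π : Profile N m p T) (F : Traj N m p T → ℝ≥0∞) :
    Fin (T + 1) → Traj N m p T → ℝ≥0∞ :=
  Fin.reverseInduction (motive := fun _ => Traj N m p T → ℝ≥0∞) F
    (fun t V ω => ∫⁻ a, ∫⁻ w, V (ω.extend t a (G.next t ω a w)) ∂(multivariateGaussian 0 G.W)
      ∂(Measure.pi fun i => π.actionLaw i t ω))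

/-- The cost of agent `i` in the period `t`, with the relative entropy of the agent's
action law with respect to the standard normal prior. -/
def stageCost (π : Profile N m p T) (i : Fin N) (t : Fin T) (ω : Traj N m p T) : ℝ≥0∞ :=
  ENNReal.ofReal ((ω.x t.castSucc).ofLp ⬝ᵥ G.Q i t.castSucc *ᵥ (ω.x t.castSucc).ofLp)
    + ENNReal.ofReal ((ω.u t i).ofLp ⬝ᵥ G.R i t *ᵥ (ω.u t i).ofLp)
    + ENNReal.ofReal G.τ * InformationTheory.klDiv (π.actionLaw i t ω) (stdGaussian (Act p))

/-- The terminal cost of agent `i`. -/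
def terminalCost (i : Fin N) (ω : Traj N m p T) : ℝ≥0∞ :=
  ENNReal.ofReal
    ((ω.x (Fin.last T)).ofLp ⬝ᵥ G.Q i (Fin.last T) *ᵥ (ω.x (Fin.last T)).ofLp)

/-- The expected cost-to-go `J^i_t` of agent `i` under the profile `π`, given the history of `ω` up
to time `t`. -/
def costToGo (π : Profile N m p T) (i : Fin N) (t : Fin (T + 1)) (ω : Traj N m p T) : ℝ≥0∞ :=
  G.expect π (fun ω' => (∑ s : Fin T with t ≤ s.castSucc, G.stageCost π i s ω')
    + G.terminalCost i ω') t ω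

/-- The expected cost `J^i(x₀, π)`. -/
def cost (π : Profile N m p T) (i : Fin N) (x₀ : State m) : ℝ≥0∞ :=
  G.costToGo π i 0 (Traj.start x₀)

/-- Nash equilibrium: from no initial state does any agent gain by a unilateral deviation. -/
def IsNash (π : Profile N m p T) : Prop :=
  ∀ x₀ i (σ : Policy m p T), G.cost π i x₀ ≤ G.cost (Function.update π i σ) i x₀

/-- Feedback (subgame perfect) Nash equilibrium: the costs-to-go are finite and the
equilibrium inequality holds at every time and after every history. -/
def IsFeedbackNash (π : Profile N m p T) : Prop :=
  (∀ i t ω, G.costToGo π i t ω ≠ ∞) ∧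
    ∀ i t ω (σ : Policy m p T), G.costToGo π i t ω ≤ G.costToGo (Function.update π i σ) i t ω

/-- The property `E` of the trajectory holds almost surely when `π` is played from `x₀`. -/
def AlmostSurely (π : Profile N m p T) (x₀ : State m) (E : Traj N m p T → Prop) : Prop :=
  G.expect π (Set.indicator {ω | ¬ E ω} 1) 0 (Traj.start x₀) = 0

/-- The matrix `(τ/2) I + R^i_t + (B^i_t)ᵀ P B^i_t`. -/
def gainMatrix (i : Fin N) (t : Fin T) (P : Matrix (Fin m) (Fin m) ℝ) :
    Matrix (Fin p) (Fin p) ℝ :=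
  (G.τ / 2) • (1 : Matrix (Fin p) (Fin p) ℝ) + G.R i t + (G.B i t)ᵀ * P * G.B i t

/-- The matrix `A^i_t = A_t + ∑ j ≠ i, B^j_t K^j_t`. -/
def othersClosedLoop (K : Fin N → Fin T → Matrix (Fin p) (Fin m) ℝ) (i : Fin N) (t : Fin T) :
    Matrix (Fin m) (Fin m) ℝ :=
  G.A t + ∑ j ∈ Finset.univ.erase i, G.B j t * K j t

/-- `P`, `K` solve the coupled Nash Riccati equations on the times `t₀, …, T` (their entries at
earlier times are irrelevant). -/
def IsNashRiccati (t₀ : Fin (T + 1)) (P : Fin N → Fin (T + 1) → Matrix (Fin m) (Fin m) ℝ)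
    (K : Fin N → Fin T → Matrix (Fin p) (Fin m) ℝ) : Prop :=
  (∀ i, P i (Fin.last T) = G.Q i (Fin.last T)) ∧
  ∀ t : Fin T, t₀ ≤ t.castSucc → ∀ i,
    K i t = -((G.gainMatrix i t (P i t.succ))⁻¹ *
      ((G.B i t)ᵀ * P i t.succ * G.othersClosedLoop K i t)) ∧
    P i t.castSucc = G.Q i t.castSucc
      + (G.othersClosedLoop K i t)ᵀ * P i t.succ * G.othersClosedLoop K i t
      - ((G.B i t)ᵀ * P i t.succ * G.othersClosedLoop K i t)ᵀ
        * (G.gainMatrix i t (P i t.succ))⁻¹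
        * ((G.B i t)ᵀ * P i t.succ * G.othersClosedLoop K i t)

end LQGame

/-- Linear Gaussian profiles: `u^i_t ∼ N(K^i_t x_t, S^i_t)` with `S^i_t` positive definite. -/
def Profile.IsLinearGaussian (π : Profile N m p T) : Prop :=
  ∃ (K : Fin N → Fin T → Matrix (Fin p) (Fin m) ℝ) (S : Fin N → Fin T → Matrix (Fin p) (Fin p) ℝ),
    (∀ i t, (S i t).PosDef) ∧
    ∀ i t ω, π.actionLaw i t ω =
      multivariateGaussian ((K i t).toEuclideanLin (ω.x t.castSucc)) (S i t)

end

/-!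
The game is solved by dynamic programming. Suppose that from time `t + 1` on the cost-to-go of agent
`i` is a quadratic function `xᵀ P x + r` of the state with `P` positive semidefinite. At time `t`,
against opponents whose actions are independent and square integrable, the cost of agent `i` is then
the free energy of its own action law for a quadratic potential, relative to the standard Gaussian
prior, and, up to a constant, the opponents enter only through their mean actions
(`exists_stageValue_update_eq`). By the Gibbs variational principle
(`freeEnergy_eq_of_ne_top`) its unique minimizer is the tilted prior, and completing the square shows that this is a Gaussian law whose covariance depends on neither the
state nor the opponents and whose mean is affine in the opponents' means
(`stdGaussian_tilted_eq`, `stageValue_response`). Hence equilibria of the one-stage game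
correspond to fixed points of the mean responses. The bound on `τ` makes the map of mean responses a
contraction, so there is exactly one fixed point and it is linear in the state
(`eq_zero_of_mean_response`, `exists_gain`). Evaluating the resulting linear Gaussian play gives
again a quadratic cost-to-go, whose matrix is the one of the Riccati recursion and is positive
semidefinite (`exists_stageValue_gaussian`, `evalMatrix_eq_riccati`). The outcome of the backward
recursion is recorded in `BellmanSolution`, which is all that the dynamic game depends on.

* The resulting profile is a feedback equilibrium because no deviation falls below the value
  function (`val_le_costToGo`). This needs no measurability of the cost-to-go of the deviating
  profile, since only monotonicity of the lower integral is used.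
* In a feedback equilibrium the costs are finite, so that all actions are square integrable. Backward
  in time, a deviation at a single time to the best response in a given history shows that the
  action laws form an equilibrium of the one-stage game (`eq_profile_of_isFeedbackNash`).
* A linear Gaussian Nash equilibrium is tested only from time `0`. Its action laws have full support,
  so the supports of the laws of its states, over all initial states, contain everything that can be
  reached by arbitrary actions and arbitrary noise in the range of the covariance. The costs-to-go
  of the equilibrium and of a linear Gaussian deviation at time `t` are continuous functions of the state, and the second
  does not exceed the first in reachable states at times up to `t`. As they agree at time `0`, they
  agree in all reachable states at time `t` (`costToGo_eq_of_le_at_zero`), and the uniqueness of the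
  best response applies there.
-/

noncomputable section

/-! ### Tilted measures and the Gibbs variational principle -/

theorem MeasureTheory.tilted_smul_measure {α : Type*} [MeasurableSpace α] (μ : Measure α)
    (f : α → ℝ) {c : ℝ≥0∞} (h0 : c ≠ 0) (hc : c ≠ ∞) : (c • μ).tilted f = μ.tilted f := by
  have hr : c.toReal ≠ 0 := ENNReal.toReal_ne_zero.2 ⟨h0, hc⟩
  have hd : ∀ x, ENNReal.ofReal (Real.exp (f x) / ∫ x, Real.exp (f x) ∂(c • μ))
      = c⁻¹ * ENNReal.ofReal (Real.exp (f x) / ∫ x, Real.exp (f x) ∂μ) := by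
    intro x
    rw [integral_smul_measure, smul_eq_mul, ← div_div, div_right_comm, div_eq_inv_mul _ c.toReal,
      ENNReal.ofReal_mul (by positivity), ENNReal.ofReal_inv_of_pos (by positivity),
      ENNReal.ofReal_toReal hc]
  ext s hs
  rw [tilted_apply' _ _ hs, tilted_apply' _ _ hs, Measure.restrict_smul, lintegral_smul_measure]
  simp_rw [hd]
  rw [lintegral_const_mul' _ _ (by simpa using h0), smul_eq_mul, ← mul_assoc,
    ENNReal.mul_inv_cancel h0 hc, one_mul]

theorem MeasureTheory.map_tilted_equiv {α β : Type*} [MeasurableSpace α] [MeasurableSpace β]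
    (μ : Measure α) (e : α ≃ᵐ β) (f : α → ℝ) :
    (μ.tilted f).map e = (μ.map e).tilted (f ∘ e.symm) := by
  ext s hs
  rw [e.map_apply, tilted_apply' _ _ (e.measurable hs), tilted_apply' _ _ hs, e.restrict_map,
    lintegral_map_equiv, integral_map_equiv]
  simp

theorem MeasureTheory.tilted_sub_const {α : Type*} [MeasurableSpace α] (μ : Measure α)
    (f : α → ℝ) (c : ℝ) : μ.tilted (fun x => f x - c) = μ.tilted f := by
  have h : ∀ x, Real.exp (f x - c) / ∫ x, Real.exp (f x - c) ∂μ
      = Real.exp (f x) / ∫ x, Real.exp (f x) ∂μ := by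
    intro x
    simp_rw [Real.exp_sub]
    rw [integral_div, div_div_div_cancel_right₀ (Real.exp_pos c).ne']
  simp only [Measure.tilted, h]

/-- The free energy `∫ f dμ + τ KL(μ ‖ ν)` of a probability measure `μ`. -/
def freeEnergy {α : Type*} [MeasurableSpace α] (ν : Measure α) (τ : ℝ) (f : α → ℝ)
    (μ : Measure α) : ℝ≥0∞ :=
  ∫⁻ x, ENNReal.ofReal (f x) ∂μ + ENNReal.ofReal τ * InformationTheory.klDiv μ ν

section Gibbs

open InformationTheory

variable {α : Type*} [MeasurableSpace α] {ν : Measure α} [IsProbabilityMeasure ν] {τ : ℝ}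
  {f : α → ℝ}

theorem integrable_exp_neg_div (hτ : 0 < τ) (hf : Measurable f) (hf0 : ∀ x, 0 ≤ f x) :
    Integrable (fun x => Real.exp (-f x / τ)) ν := by
  refine Integrable.of_bound (C := 1) (by fun_prop) (ae_of_all _ fun x => ?_)
  rw [Real.norm_eq_abs, abs_of_pos (Real.exp_pos _), Real.exp_le_one_iff]
  have := hf0 x
  rw [neg_div, neg_nonpos]
  positivity

/-- A measure of finite free energy has free energy `-τ log Z` plus `τ` times its relative entropy
with respect to the Gibbs measure, where `Z` is the partition function. -/
theorem freeEnergy_eq_of_ne_top (hτ : 0 < τ) (hf : Measurable f) (hf0 : ∀ x, 0 ≤ f x)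
    {μ : Measure α} [IsProbabilityMeasure μ] (h : freeEnergy ν τ f μ ≠ ∞) :
    freeEnergy ν τ f μ = ENNReal.ofReal (-τ * Real.log (∫ x, Real.exp (-f x / τ) ∂ν))
      + ENNReal.ofReal τ * klDiv μ (ν.tilted fun x => -f x / τ) := by
  have he := integrable_exp_neg_div (ν := ν) hτ hf hf0
  have : IsProbabilityMeasure (ν.tilted fun x => -f x / τ) := isProbabilityMeasure_tilted he
  obtain ⟨h1, h2⟩ := ENNReal.add_ne_top.1 h
  have hτ' : ENNReal.ofReal τ ≠ 0 := by simpa using hτ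
  have hk : klDiv μ ν ≠ ∞ := fun hk => h2 (by rw [hk, ENNReal.mul_top hτ'])
  obtain ⟨hac, hint⟩ := klDiv_ne_top_iff.1 hk
  have hfi : Integrable f μ := by
    refine (lintegral_ofReal_ne_top_iff_integrable hf.aestronglyMeasurable (ae_of_all _ hf0)).1 h1
  have hfi' : Integrable (fun x => -f x / τ) μ := (hfi.neg).div_const τ
  have hac' : μ ≪ ν.tilted fun x => -f x / τ := hac.trans (absolutelyContinuous_tilted he)
  have hint' := integrable_llr_tilted_right hac hfi' hint he
  have hZ : Real.log (∫ x, Real.exp (-f x / τ) ∂ν) ≤ 0 := by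
    refine Real.log_nonpos (integral_nonneg fun x => (Real.exp_pos _).le) ?_
    calc _ ≤ ∫ x, (1 : ℝ) ∂ν := integral_mono he (integrable_const _) fun x => by
            have := hf0 x
            simp only [Real.exp_le_one_iff, neg_div, neg_nonpos]
            positivity
      _ = 1 := by simp
  have e1 := integral_llr_add_sub_measure_univ_nonneg hac hint
  have e2 := integral_llr_add_sub_measure_univ_nonneg hac' hint'
  have e3 := integral_llr_tilted_right hac hfi' he hint
  rw [freeEnergy, klDiv_of_ac_of_integrable hac hint, klDiv_of_ac_of_integrable hac' hint',
    ← ofReal_integral_eq_lintegral_ofReal hfi (ae_of_all _ hf0), ← ENNReal.ofReal_mul hτ.le,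
    ← ENNReal.ofReal_mul hτ.le, ← ENNReal.ofReal_add (integral_nonneg hf0) (by positivity),
    ← ENNReal.ofReal_add (by nlinarith) (by positivity), e3, integral_div, integral_neg]
  congr 1
  simp only [probReal_univ]
  field_simp
  ring

theorem freeEnergy_gibbs_ne_top (hτ : 0 < τ) (hf : Measurable f) (hf0 : ∀ x, 0 ≤ f x) :
    freeEnergy ν τ f (ν.tilted fun x => -f x / τ) ≠ ∞ := by
  have he := integrable_exp_neg_div (ν := ν) hτ hf hf0
  have : IsProbabilityMeasure (ν.tilted fun x => -f x / τ) := isProbabilityMeasure_tilted he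
  have hfi : Integrable f (ν.tilted fun x => -f x / τ) := by
    rw [integrable_tilted_iff he]
    -- `s e^{-s/τ} ≤ τ` for `s ≥ 0`
    refine Integrable.of_bound (C := τ) (by fun_prop) (ae_of_all _ fun x => ?_)
    have h1 := hf0 x
    rw [Real.norm_eq_abs, smul_eq_mul, abs_of_nonneg (by positivity), neg_div, Real.exp_neg,
      inv_mul_le_iff₀ (Real.exp_pos _)]
    have h2 := Real.add_one_le_exp (f x / τ)
    calc f x = (f x / τ) * τ := by field_simp
      _ ≤ Real.exp (f x / τ) * τ := by gcongr; linarith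
  have hac : (ν.tilted fun x => -f x / τ) ≪ ν := tilted_absolutelyContinuous _ _
  have hl : Integrable (llr (ν.tilted fun x => -f x / τ) ν) (ν.tilted fun x => -f x / τ) := by
    have hl : llr (ν.tilted fun x => -f x / τ) ν =ᵐ[ν.tilted fun x => -f x / τ] _ :=
      hac.ae_eq (log_rnDeriv_tilted_left_self he)
    refine Integrable.congr ?_ hl.symm
    exact ((hfi.neg).div_const τ).sub (integrable_const _)
  refine ENNReal.add_ne_top.2 ⟨?_, ENNReal.mul_ne_top (by simp) (klDiv_ne_top hac hl)⟩
  exact (lintegral_ofReal_ne_top_iff_integrable hf.aestronglyMeasurable (ae_of_all _ hf0)).2 hfi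

theorem freeEnergy_gibbs_le (hτ : 0 < τ) (hf : Measurable f) (hf0 : ∀ x, 0 ≤ f x)
    (μ : Measure α) [IsProbabilityMeasure μ] :
    freeEnergy ν τ f (ν.tilted fun x => -f x / τ) ≤ freeEnergy ν τ f μ := by
  have he := integrable_exp_neg_div (ν := ν) hτ hf hf0
  have : IsProbabilityMeasure (ν.tilted fun x => -f x / τ) := isProbabilityMeasure_tilted he
  by_cases h : freeEnergy ν τ f μ = ∞
  · simp [h]
  rw [freeEnergy_eq_of_ne_top hτ hf hf0 h,
    freeEnergy_eq_of_ne_top hτ hf hf0 (freeEnergy_gibbs_ne_top hτ hf hf0), klDiv_self]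
  simp

theorem eq_gibbs_of_freeEnergy_le (hτ : 0 < τ) (hf : Measurable f) (hf0 : ∀ x, 0 ≤ f x)
    {μ : Measure α} [IsProbabilityMeasure μ]
    (h : freeEnergy ν τ f μ ≤ freeEnergy ν τ f (ν.tilted fun x => -f x / τ)) :
    μ = ν.tilted fun x => -f x / τ := by
  have he := integrable_exp_neg_div (ν := ν) hτ hf hf0
  have : IsProbabilityMeasure (ν.tilted fun x => -f x / τ) := isProbabilityMeasure_tilted he
  have ht := freeEnergy_gibbs_ne_top (ν := ν) hτ hf hf0
  have ht' := ne_top_of_le_ne_top ht h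
  rw [freeEnergy_eq_of_ne_top hτ hf hf0 ht', freeEnergy_eq_of_ne_top hτ hf hf0 ht, klDiv_self,
    mul_zero, add_zero] at h
  rw [← klDiv_eq_zero_iff]
  have h0 := (ENNReal.cancel_of_ne ENNReal.ofReal_ne_top).add_le_iff_nonpos_right.1 h
  have hτ' : ENNReal.ofReal τ ≠ 0 := by simpa using hτ
  simpa [hτ'] using h0

end Gibbs

/-! ### Gaussian measures on Euclidean space -/

/-- The quadratic form `xᵀ M x`. -/
def quadForm {ι : Type*} [Fintype ι] (M : Matrix ι ι ℝ) (x : EuclideanSpace ℝ ι) : ℝ :=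
  x.ofLp ⬝ᵥ M *ᵥ x.ofLp

/-- The bias-variance decomposition of a second moment. -/
theorem integral_norm_add_sq {Ω E : Type*} [MeasurableSpace Ω] [NormedAddCommGroup E]
    [InnerProductSpace ℝ E] [CompleteSpace E] {μ : Measure Ω} [IsProbabilityMeasure μ]
    {Z : Ω → E} (hZ : MemLp Z 2 μ) (v : E) :
    ∫ ω, ‖v + Z ω‖ ^ 2 ∂μ
      = ‖v + ∫ ω, Z ω ∂μ‖ ^ 2 + (∫ ω, ‖Z ω‖ ^ 2 ∂μ - ‖∫ ω, Z ω ∂μ‖ ^ 2) := by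
  have h1 : Integrable Z μ := hZ.integrable (by norm_num)
  have h2 : Integrable (fun ω => ‖Z ω‖ ^ 2) μ := hZ.integrable_norm_pow (by norm_num)
  have h3 : Integrable (fun ω => 2 * inner ℝ v (Z ω)) μ := (h1.const_inner v).const_mul 2
  have h4 : Integrable (fun ω => ‖v‖ ^ 2 + 2 * inner ℝ v (Z ω)) μ := (integrable_const _).add h3
  simp_rw [norm_add_sq_real]
  rw [integral_add h4 h2, integral_add (integrable_const _) h3, integral_const_mul,
    integral_inner h1]
  simp

section Gaussian

variable {ι : Type*} [Fintype ι]

@[fun_prop]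
theorem continuous_quadForm (M : Matrix ι ι ℝ) : Continuous (quadForm M) := by
  unfold quadForm; fun_prop

@[fun_prop]
theorem measurable_quadForm (M : Matrix ι ι ℝ) : Measurable (quadForm M) :=
  (continuous_quadForm M).measurable

theorem quadForm_nonneg {M : Matrix ι ι ℝ} (hM : M.PosSemidef) (x : EuclideanSpace ℝ ι) :
    0 ≤ quadForm M x := by
  simpa [quadForm] using hM.dotProduct_mulVec_nonneg x.ofLp

theorem quadForm_sub {M : Matrix ι ι ℝ} (hM : Mᵀ = M) (x y : EuclideanSpace ℝ ι) :
    quadForm M (x - y) = quadForm M x - 2 * (x.ofLp ⬝ᵥ M *ᵥ y.ofLp) + quadForm M y := by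
  have : y.ofLp ⬝ᵥ M *ᵥ x.ofLp = x.ofLp ⬝ᵥ M *ᵥ y.ofLp := by
    rw [dotProduct_comm, ← Matrix.vecMul_transpose, hM, Matrix.dotProduct_mulVec]
  simp only [quadForm, WithLp.ofLp_sub, Matrix.mulVec_sub, dotProduct_sub, sub_dotProduct, this]
  ring

theorem integrable_exp_neg_sq :
    Integrable fun x : EuclideanSpace ℝ ι => Real.exp (-‖x‖ ^ 2 / 2) := by
  have h := (GaussianFourier.integrable_cexp_neg_mul_sq_norm_add (b := 1 / 2)
    (V := EuclideanSpace ℝ ι) (by norm_num) 0 0).re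
  refine h.congr (ae_of_all _ fun x => ?_)
  simp only [zero_mul, add_zero]
  rw [show (-(1 / 2) * (‖x‖ : ℂ) ^ 2) = ((-‖x‖ ^ 2 / 2 : ℝ) : ℂ) by push_cast; ring,
    ← Complex.ofReal_exp, RCLike.re_eq_complex_re, Complex.ofReal_re]

theorem stdGaussian_eq_tilted :
    stdGaussian (EuclideanSpace ℝ ι) = volume.tilted fun x => -‖x‖ ^ 2 / 2 := by
  have : IsProbabilityMeasure ((volume : Measure (EuclideanSpace ℝ ι)).tilted
    fun x => -‖x‖ ^ 2 / 2) := isProbabilityMeasure_tilted integrable_exp_neg_sq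
  refine Measure.ext_of_charFun ?_
  ext t
  have e : ∀ x : EuclideanSpace ℝ ι, Complex.exp (-(1 / 2) * (‖x‖ : ℂ) ^ 2)
      = ((Real.exp (-‖x‖ ^ 2 / 2) : ℝ) : ℂ) := by
    intro x; push_cast; congr 1; ring
  have h1 := GaussianFourier.integral_cexp_neg_mul_sq_norm_add (b := 1 / 2)
    (V := EuclideanSpace ℝ ι) (by norm_num) Complex.I t
  have h0 := GaussianFourier.integral_cexp_neg_mul_sq_norm_add (b := 1 / 2)
    (V := EuclideanSpace ℝ ι) (by norm_num) 0 0
  simp only [zero_mul, add_zero, e, integral_complex_ofReal, Complex.exp_add] at h0 h1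
  rw [finrank_euclideanSpace] at h1
  norm_num at h0
  rw [charFun_stdGaussian, charFun_apply, integral_tilted]
  have : ∀ x : EuclideanSpace ℝ ι, (Real.exp (-‖x‖ ^ 2 / 2) / ∫ x : EuclideanSpace ℝ ι,
      Real.exp (-‖x‖ ^ 2 / 2)) • Complex.exp (inner ℝ x t * Complex.I)
      = ((∫ x : EuclideanSpace ℝ ι, Real.exp (-‖x‖ ^ 2 / 2) : ℝ) : ℂ)⁻¹ *
        (((Real.exp (-‖x‖ ^ 2 / 2) : ℝ) : ℂ) * Complex.exp (Complex.I * inner ℝ t x)) := by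
    intro x
    rw [Complex.real_smul, real_inner_comm, mul_comm Complex.I]
    push_cast
    ring
  simp_rw [this]
  rw [integral_const_mul, h1, h0, ← mul_assoc]
  have hne : ((∫ x : EuclideanSpace ℝ ι, Real.exp (-‖x‖ ^ 2 / 2) : ℝ) : ℂ) ≠ 0 := by
    have := integral_exp_pos (integrable_exp_neg_sq (ι := ι))
    exact_mod_cast this.ne'
  rw [h0] at hne
  rw [inv_mul_cancel₀ hne, one_mul]
  congr 1
  norm_num

variable [DecidableEq ι]

open scoped MatrixOrder in
/-- A nondegenerate Gaussian law is the image of the standard one under an invertible affine map,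
whose linear part is the symmetric square root of the covariance matrix. -/
theorem exists_multivariateGaussian_eq_map {S : Matrix ι ι ℝ} (hS : S.PosDef) :
    ∃ (C : Matrix ι ι ℝ) (L : EuclideanSpace ℝ ι ≃L[ℝ] EuclideanSpace ℝ ι), C * C = S ∧ Cᵀ = C ∧
      IsUnit C.det ∧ (∀ x, L x = WithLp.toLp 2 (C *ᵥ x.ofLp)) ∧
      ∀ d, multivariateGaussian d S
        = (stdGaussian (EuclideanSpace ℝ ι)).map fun x => d + L x := by
  have hCC : CFC.sqrt S * CFC.sqrt S = S := CFC.sqrt_mul_sqrt_self S hS.posSemidef.nonneg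
  have hCu : IsUnit (CFC.sqrt S).det := by
    have := (Matrix.isUnit_iff_isUnit_det _).1 hS.isUnit
    rw [← hCC, Matrix.det_mul] at this
    exact isUnit_of_mul_isUnit_left this
  have hCs : (CFC.sqrt S)ᵀ = CFC.sqrt S := by
    have := (CFC.sqrt_nonneg S).isSelfAdjoint
    simpa [IsSelfAdjoint, Matrix.star_eq_conjTranspose] using this
  refine ⟨CFC.sqrt S, ContinuousLinearEquiv.equivOfInverse
    (Matrix.toEuclideanCLM (𝕜 := ℝ) (CFC.sqrt S)) (Matrix.toEuclideanCLM (𝕜 := ℝ) (CFC.sqrt S)⁻¹)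
    (fun x => ?_) (fun x => ?_), hCC, hCs, hCu, fun x => rfl, fun d => rfl⟩
  · rw [← mul_apply_eq_comp, ← map_mul, Matrix.nonsing_inv_mul _ hCu, map_one]
    rfl
  · rw [← mul_apply_eq_comp, ← map_mul, Matrix.mul_nonsing_inv _ hCu, map_one]
    rfl

/-- The density of a nondegenerate Gaussian law. -/
theorem multivariateGaussian_eq_tilted (d : EuclideanSpace ℝ ι) {S : Matrix ι ι ℝ}
    (hS : S.PosDef) :
    multivariateGaussian d S = volume.tilted fun x => -quadForm S⁻¹ (x - d) / 2 := by
  obtain ⟨C, L, hCC, hCs, hCu, hL, hmap⟩ := exists_multivariateGaussian_eq_map hS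
  let e : EuclideanSpace ℝ ι ≃ᵐ EuclideanSpace ℝ ι :=
    (L.toHomeomorph.trans (Homeomorph.addLeft d)).toMeasurableEquiv
  have he : ∀ x, e x = d + L x := fun x => rfl
  obtain ⟨c, h0, hc, hvol⟩ : ∃ c : ℝ≥0∞, c ≠ 0 ∧ c ≠ ∞ ∧
      (volume : Measure (EuclideanSpace ℝ ι)).map e = c • volume := by
    have hdet :
        LinearMap.det (L.toLinearEquiv : EuclideanSpace ℝ ι →ₗ[ℝ] EuclideanSpace ℝ ι) ≠ 0 :=
      L.toLinearEquiv.isUnit_det'.ne_zero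
    have h : (volume : Measure (EuclideanSpace ℝ ι)).map L = _ :=
      Measure.map_linearMap_addHaar_eq_smul_addHaar volume hdet
    refine ⟨_, (ENNReal.ofReal_pos.2 (abs_pos.2 (inv_ne_zero hdet))).ne',
      ENNReal.ofReal_ne_top, ?_⟩
    have h' : (volume : Measure (EuclideanSpace ℝ ι)).map e
        = ((volume : Measure (EuclideanSpace ℝ ι)).map L).map fun x => d + x := by
      rw [Measure.map_map (by fun_prop) (by fun_prop)]
      rfl
    rw [h', h, Measure.map_smul, (measurePreserving_add_left volume d).map_eq]
  rw [hmap d, show (fun x => d + L x) = e from rfl, stdGaussian_eq_tilted, map_tilted_equiv, hvol,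
    tilted_smul_measure _ _ h0 hc]
  congr 1
  ext x
  obtain ⟨z, rfl⟩ := e.surjective x
  rw [Function.comp_apply, e.symm_apply_apply, he, add_sub_cancel_left, quadForm, hL]
  have : ‖z‖ ^ 2 = z.ofLp ⬝ᵥ z.ofLp := by
    rw [EuclideanSpace.real_norm_sq_eq]; simp [dotProduct, sq]
  rw [this, Matrix.mulVec_mulVec, ← hCC, Matrix.mul_inv_rev, Matrix.mul_assoc,
    Matrix.nonsing_inv_mul _ hCu, mul_one, Matrix.dotProduct_mulVec, ← Matrix.mulVec_transpose,
    Matrix.transpose_nonsing_inv, hCs, Matrix.mulVec_mulVec, Matrix.nonsing_inv_mul _ hCu,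
    Matrix.one_mulVec]

theorem multivariateGaussian_eq_map_add (d : EuclideanSpace ℝ ι) (S : Matrix ι ι ℝ) :
    multivariateGaussian d S = (multivariateGaussian 0 S).map fun x => d + x := by
  rw [multivariateGaussian, multivariateGaussian, Measure.map_map (by fun_prop) (by fun_prop)]
  simp [Function.comp_def]

theorem quadForm_eq_inner (M : Matrix ι ι ℝ) (x : EuclideanSpace ℝ ι) :
    quadForm M x = inner ℝ x (Matrix.toEuclideanCLM (𝕜 := ℝ) M x) :=
  (Matrix.inner_toEuclideanCLM M x x).symm

theorem quadForm_one (x : EuclideanSpace ℝ ι) : quadForm 1 x = ‖x‖ ^ 2 := by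
  rw [quadForm_eq_inner, map_one, one_apply_eq_self, real_inner_self_eq_norm_sq]

theorem integrable_quadForm {μ : Measure (EuclideanSpace ℝ ι)} (hμ : MemLp id 2 μ)
    (M : Matrix ι ι ℝ) : Integrable (quadForm M) μ := by
  have h := (hμ.integrable_norm_pow (by norm_num)).const_mul
    ‖Matrix.toEuclideanCLM (𝕜 := ℝ) M‖
  refine h.mono' (by fun_prop) (ae_of_all _ fun x => ?_)
  rw [quadForm_eq_inner]
  calc _ ≤ ‖x‖ * ‖Matrix.toEuclideanCLM (𝕜 := ℝ) M x‖ := norm_inner_le_norm _ _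
    _ ≤ ‖x‖ * (‖Matrix.toEuclideanCLM (𝕜 := ℝ) M‖ * ‖x‖) := by
      gcongr; exact ContinuousLinearMap.le_opNorm _ _
    _ = _ := by simp; ring

/-- Shifting a nondegenerate Gaussian law changes its relative entropy by half the squared norm of
the mean. -/
theorem klDiv_multivariateGaussian {S : Matrix ι ι ℝ} (hS : S.PosDef) :
    ∃ c : ℝ, ∀ d : EuclideanSpace ℝ ι, 0 ≤ ‖d‖ ^ 2 / 2 + c ∧
      InformationTheory.klDiv (multivariateGaussian d S) (stdGaussian (EuclideanSpace ℝ ι))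
        = ENNReal.ofReal (‖d‖ ^ 2 / 2 + c) := by
  set ν := stdGaussian (EuclideanSpace ℝ ι) with hν
  set Z : ℝ := (∫ x : EuclideanSpace ℝ ι, Real.exp (-quadForm S⁻¹ x / 2)) /
    ∫ x : EuclideanSpace ℝ ι, Real.exp (-‖x‖ ^ 2 / 2)
  refine ⟨-(∫ x, quadForm S⁻¹ x ∂(multivariateGaussian 0 S)) / 2
    + (∫ x, ‖x‖ ^ 2 ∂(multivariateGaussian 0 S)) / 2 - Real.log Z, fun d => ?_⟩
  set μ := multivariateGaussian d S
  set g : EuclideanSpace ℝ ι → ℝ := fun u => -quadForm S⁻¹ (u - d) / 2 + ‖u‖ ^ 2 / 2 with hg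
  have hsum : (fun x : EuclideanSpace ℝ ι => -‖x‖ ^ 2 / 2) + g
      = fun x => -quadForm S⁻¹ (x - d) / 2 := by
    ext x; simp only [Pi.add_apply, hg]; ring
  have hμ : μ = ν.tilted g := by
    rw [hν, stdGaussian_eq_tilted, tilted_tilted integrable_exp_neg_sq, hsum]
    exact multivariateGaussian_eq_tilted d hS
  have he : Integrable (fun x => Real.exp (g x)) ν := by
    by_contra h
    rw [tilted_of_not_integrable h] at hμ
    exact IsProbabilityMeasure.ne_zero μ hμ
  have hZ : ∫ x, Real.exp (g x) ∂ν = Z := by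
    rw [hν, stdGaussian_eq_tilted, integral_exp_tilted, hsum,
      integral_sub_right_eq_self (fun x => Real.exp (-quadForm S⁻¹ x / 2)) d]
  have hac : μ ≪ ν := hμ ▸ tilted_absolutelyContinuous _ _
  have hl : llr μ ν =ᵐ[μ] fun x => g x - Real.log Z := by
    rw [← hZ]
    refine hac.ae_eq ?_
    rw [hμ]
    exact log_rnDeriv_tilted_left_self he
  have hlp : MemLp id 2 (multivariateGaussian (0 : EuclideanSpace ℝ ι) S) :=
    IsGaussian.memLp_two_id
  have hq := integrable_quadForm hlp S⁻¹
  have hn : Integrable (fun x => ‖d + x‖ ^ 2) (multivariateGaussian (0 : EuclideanSpace ℝ ι) S) :=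
    ((memLp_const d).add hlp).integrable_norm_pow (by norm_num)
  have hmap : μ = (multivariateGaussian 0 S).map fun x => d + x :=
    multivariateGaussian_eq_map_add d S
  have hq' : Integrable (fun x => -quadForm S⁻¹ x / 2)
      (multivariateGaussian (0 : EuclideanSpace ℝ ι) S) := hq.neg.div_const 2
  have hgc : Continuous g := by fun_prop
  have hcomp : g ∘ (fun x => d + x) = fun x => -quadForm S⁻¹ x / 2 + ‖d + x‖ ^ 2 / 2 := by
    ext x; simp [hg]
  have hgi : Integrable g μ := by
    rw [hmap, integrable_map_measure hgc.aestronglyMeasurable (by fun_prop), hcomp]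
    exact hq'.add (hn.div_const 2)
  have hli : Integrable (llr μ ν) μ := (hgi.sub (integrable_const _)).congr hl.symm
  have hval : ∫ x, llr μ ν x ∂μ = ‖d‖ ^ 2 / 2 + (-(∫ x, quadForm S⁻¹ x
      ∂(multivariateGaussian 0 S)) / 2 + (∫ x, ‖x‖ ^ 2 ∂(multivariateGaussian 0 S)) / 2
      - Real.log Z) := by
    have h2 := integral_norm_add_sq hlp d
    simp only [id_eq, integral_id_multivariateGaussian, add_zero] at h2
    rw [integral_congr_ae hl, integral_sub hgi (integrable_const _), hmap,
      integral_map (by fun_prop) hgc.aestronglyMeasurable]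
    change ∫ x, (g ∘ (fun x => d + x)) x ∂_ - _ = _
    rw [hcomp, integral_add hq' (hn.div_const 2), integral_div, integral_div,
      integral_neg, h2]
    simp
    ring
  have hk := InformationTheory.integral_llr_add_sub_measure_univ_nonneg hac hli
  rw [InformationTheory.klDiv_of_ac_of_integrable hac hli]
  simp only [probReal_univ, add_sub_cancel_right] at hk ⊢
  rw [hval] at hk ⊢
  exact ⟨hk, rfl⟩

/-- Completing the square: the Gibbs measure of a quadratic potential with respect to the standard
Gaussian law is Gaussian. -/
theorem stdGaussian_tilted_eq {τ : ℝ} (hτ : 0 < τ) {H : Matrix ι ι ℝ}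
    (hG : ((τ / 2) • (1 : Matrix ι ι ℝ) + H).PosDef) (b d : EuclideanSpace ℝ ι) (c : ℝ)
    (hd : ((τ / 2) • (1 : Matrix ι ι ℝ) + H) *ᵥ d.ofLp = -b.ofLp) :
    (stdGaussian (EuclideanSpace ℝ ι)).tilted
        (fun u => -(quadForm H u + 2 * (b.ofLp ⬝ᵥ u.ofLp) + c) / τ)
      = multivariateGaussian d ((τ / 2) • ((τ / 2) • (1 : Matrix ι ι ℝ) + H)⁻¹) := by
  set G := (τ / 2) • (1 : Matrix ι ι ℝ) + H with hGdef
  have hGs : Gᵀ = G := by simpa using hG.isHermitian.eq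
  have hGu : IsUnit G.det := (Matrix.isUnit_iff_isUnit_det _).1 hG.isUnit
  have hS : ((τ / 2) • G⁻¹).PosDef := hG.inv.smul (by positivity)
  have hSinv : ((τ / 2) • G⁻¹)⁻¹ = (2 / τ) • G := by
    apply Matrix.inv_eq_left_inv
    rw [Matrix.smul_mul, Matrix.mul_smul, Matrix.mul_nonsing_inv _ hGu, smul_smul]
    rw [show 2 / τ * (τ / 2) = 1 by field_simp, one_smul]
  rw [multivariateGaussian_eq_tilted d hS, stdGaussian_eq_tilted,
    tilted_tilted integrable_exp_neg_sq, hSinv,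
    ← tilted_sub_const _ (fun x => -quadForm ((2 / τ) • G) (x - d) / 2)
      ((c - quadForm G d) / τ)]
  congr 1
  ext u
  have h1 := quadForm_sub hGs u d
  have h2 : quadForm G u = τ / 2 * ‖u‖ ^ 2 + quadForm H u := by
    rw [← quadForm_one]
    simp [quadForm, hGdef, Matrix.add_mulVec, Matrix.smul_mulVec]
  have h3 : quadForm ((2 / τ) • G) (u - d) = 2 / τ * quadForm G (u - d) := by
    simp [quadForm, Matrix.smul_mulVec]
  have h4 : u.ofLp ⬝ᵥ G *ᵥ d.ofLp = -(b.ofLp ⬝ᵥ u.ofLp) := by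
    rw [hd, dotProduct_neg, dotProduct_comm]
  rw [Pi.add_apply, h3, h1, h2, h4]
  field_simp
  ring

/-- Nondegenerate Gaussian laws have full support. -/
theorem isOpenPosMeasure_multivariateGaussian (d : EuclideanSpace ℝ ι) {S : Matrix ι ι ℝ}
    (hS : S.PosDef) : (multivariateGaussian d S).IsOpenPosMeasure := by
  have he : Integrable fun x : EuclideanSpace ℝ ι => Real.exp (-quadForm S⁻¹ (x - d) / 2) := by
    by_contra h
    have := multivariateGaussian_eq_tilted d hS
    rw [tilted_of_not_integrable h] at this
    exact IsProbabilityMeasure.ne_zero _ this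
  rw [multivariateGaussian_eq_tilted d hS]
  exact (absolutelyContinuous_tilted he).isOpenPosMeasure

end Gaussian

variable {N m p T : ℕ}

/-! ### Quadratic costs of square-integrable random vectors -/

section Quadratic

variable {ι κ : Type*} [Fintype ι] [Fintype κ]

theorem quadForm_toEuclideanLin [DecidableEq κ] (P : Matrix ι ι ℝ) (M : Matrix ι κ ℝ)
    (x : EuclideanSpace ℝ κ) :
    quadForm P (M.toEuclideanLin x) = quadForm (Mᵀ * P * M) x := by
  simp only [quadForm, Matrix.toLpLin_apply, ← Matrix.mulVec_mulVec]
  rw [Matrix.dotProduct_mulVec x.ofLp, Matrix.vecMul_transpose]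

theorem quadForm_add_matrix (M M' : Matrix ι ι ℝ) (x : EuclideanSpace ℝ ι) :
    quadForm (M + M') x = quadForm M x + quadForm M' x := by
  simp [quadForm, Matrix.add_mulVec]

theorem quadForm_smul_matrix (c : ℝ) (M : Matrix ι ι ℝ) (x : EuclideanSpace ℝ ι) :
    quadForm (c • M) x = c * quadForm M x := by
  simp [quadForm, Matrix.smul_mulVec]

variable [DecidableEq ι]

open scoped MatrixOrder in
/-- Averaging a positive semidefinite quadratic form over a square-integrable shift evaluates it at
the mean, up to a constant that does not depend on the point. -/
theorem exists_lintegral_quadForm_add {Ω : Type*} [MeasurableSpace Ω] {μ : Measure Ω}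
    [IsProbabilityMeasure μ] {Z : Ω → EuclideanSpace ℝ ι} (hZ : MemLp Z 2 μ)
    {P : Matrix ι ι ℝ} (hP : P.PosSemidef) {r : ℝ} (hr : 0 ≤ r) :
    ∃ c, 0 ≤ c ∧ ∀ v, ∫⁻ ω, ENNReal.ofReal (quadForm P (v + Z ω) + r) ∂μ
      = ENNReal.ofReal (quadForm P (v + ∫ ω, Z ω ∂μ) + c) := by
  obtain ⟨D, hD⟩ := CStarAlgebra.nonneg_iff_eq_star_mul_self.1 hP.nonneg
  rw [Matrix.star_eq_conjTranspose] at hD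
  set L := Matrix.toEuclideanCLM (𝕜 := ℝ) D
  have hq : ∀ x, quadForm P x = ‖L x‖ ^ 2 := by
    intro x
    rw [← quadForm_one]
    change _ = quadForm 1 (D.toEuclideanLin x)
    rw [quadForm_toEuclideanLin, hD]
    simp
  have hLZ : MemLp (fun ω => L (Z ω)) 2 μ := L.comp_memLp' hZ
  have hint : ∫ ω, L (Z ω) ∂μ = L (∫ ω, Z ω ∂μ) :=
    L.integral_comp_comm (hZ.integrable (by norm_num))
  have hmain := integral_norm_add_sq hLZ
  set c := ∫ ω, ‖L (Z ω)‖ ^ 2 ∂μ - ‖∫ ω, L (Z ω) ∂μ‖ ^ 2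
  have hc : 0 ≤ c := by
    have h := hmain (-∫ ω, L (Z ω) ∂μ)
    simp only [neg_add_cancel, norm_zero, ne_eq, OfNat.ofNat_ne_zero, not_false_eq_true, zero_pow,
      zero_add] at h
    rw [← h]
    exact integral_nonneg fun _ => by positivity
  refine ⟨c + r, by positivity, fun v => ?_⟩
  have hi : Integrable (fun ω => ‖L v + L (Z ω)‖ ^ 2) μ :=
    ((memLp_const (L v)).add hLZ).integrable_norm_pow (by norm_num)
  have hi' : Integrable (fun ω => ‖L v + L (Z ω)‖ ^ 2 + r) μ := hi.add (integrable_const r)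
  simp_rw [hq, map_add]
  rw [← ofReal_integral_eq_lintegral_ofReal hi'
    (ae_of_all _ fun ω => by positivity), integral_add hi (integrable_const r), hmain, hint]
  simp [add_assoc]

/-- A positive definite quadratic form controls the norm, so that laws of finite cost are square
integrable. -/
theorem memLp_two_of_lintegral_quadForm_ne_top {μ : Measure (EuclideanSpace ℝ ι)}
    {R : Matrix ι ι ℝ} (hR : R.PosDef)
    (h : ∫⁻ u, ENNReal.ofReal (quadForm R u) ∂μ ≠ ∞) : MemLp id 2 μ := by
  obtain ⟨C, L, hCC, hCs, -, hL, -⟩ := exists_multivariateGaussian_eq_map hR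
  have hq : ∀ x, quadForm R x = ‖L x‖ ^ 2 := by
    intro x
    rw [← quadForm_one, hL]
    have := quadForm_toEuclideanLin 1 C x
    rw [Matrix.toLpLin_apply] at this
    rw [this, mul_one, hCs, hCC]
  have hi : Integrable (quadForm R) μ := (lintegral_ofReal_ne_top_iff_integrable
    (by fun_prop) (ae_of_all _ (quadForm_nonneg hR.posSemidef))).1 h
  rw [memLp_two_iff_integrable_sq_norm (by fun_prop)]
  refine (hi.const_mul (‖(L.symm : EuclideanSpace ℝ ι →L[ℝ] EuclideanSpace ℝ ι)‖ ^ 2)).mono'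
    (by fun_prop) (ae_of_all _ fun x => ?_)
  rw [hq, ← mul_pow, Real.norm_eq_abs, abs_of_nonneg (by positivity)]
  have := (L.symm : EuclideanSpace ℝ ι →L[ℝ] EuclideanSpace ℝ ι).le_opNorm (L x)
  simp only [ContinuousLinearEquiv.coe_coe, ContinuousLinearEquiv.symm_apply_apply] at this
  exact pow_le_pow_left₀ (norm_nonneg _) this 2

end Quadratic

theorem measurable_update_prod {ι : Type*} [DecidableEq ι] {X : Type*} [MeasurableSpace X]
    (i : ι) : Measurable fun z : X × (ι → X) => Function.update z.2 i z.1 := by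
  refine measurable_pi_iff.2 fun j => ?_
  by_cases h : j = i
  · subst h; simpa using measurable_fst
  · simp only [ne_eq, h, not_false_eq_true, Function.update_of_ne]
    fun_prop

/-- Replacing one factor of a product measure. -/
theorem MeasureTheory.Measure.pi_update_eq_map {ι : Type*} [Fintype ι] [DecidableEq ι]
    {X : Type*} [MeasurableSpace X] (μ : ι → Measure X) [∀ i, IsProbabilityMeasure (μ i)]
    (i : ι) (ν : Measure X) [IsProbabilityMeasure ν] :
    Measure.pi (Function.update μ i ν)
      = (ν.prod (Measure.pi μ)).map fun z => Function.update z.2 i z.1 := by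
  have hp : ∀ j, IsProbabilityMeasure (Function.update μ i ν j) := by
    intro j
    by_cases h : j = i
    · subst h; simpa
    · simpa [h] using inferInstanceAs (IsProbabilityMeasure (μ j))
  have hm := measurable_update_prod (X := X) i
  refine Measure.pi_eq fun s hs => ?_
  rw [Measure.map_apply hm (MeasurableSet.univ_pi hs)]
  have : (fun z : X × (ι → X) => Function.update z.2 i z.1) ⁻¹' Set.univ.pi s
      = s i ×ˢ Set.univ.pi (Function.update s i Set.univ) := by
    ext ⟨u, a⟩
    simp only [Set.mem_preimage, Set.mem_pi, Set.mem_univ, true_implies, Set.mem_prod]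
    constructor
    · refine fun h => ⟨by simpa using h i, fun j => ?_⟩
      by_cases hj : j = i
      · subst hj; simp
      · simpa [hj] using h j
    · rintro ⟨h1, h2⟩ j
      by_cases hj : j = i
      · subst hj; simpa
      · simpa [hj] using h2 j
  rw [this, Measure.prod_prod, Measure.pi_pi, ← Finset.mul_prod_erase _ _ (Finset.mem_univ i),
    ← Finset.mul_prod_erase (a := i) _ _ (Finset.mem_univ i)]
  simp only [Function.update_self, measure_univ, one_mul]
  congr 1
  refine Finset.prod_congr rfl fun j hj => ?_
  simp [Finset.ne_of_mem_erase hj]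

namespace LQGame

variable (G : LQGame N m p T)

/-! ### The one-stage game -/

/-- The next state, as a function of the current state, the actions and the noise. -/
def step (t : Fin T) (x : State m) (a : Fin N → Act p) (w : State m) : State m :=
  (G.A t).toEuclideanLin x + ∑ i, (G.B i t).toEuclideanLin (a i) + w

/-- The expected cost of agent `i` from time `t` on, when the state is `x`, the actions are drawn
independently from the laws `μ`, and `V` is the cost-to-go as a function of the next state. -/
def stageValue (i : Fin N) (t : Fin T) (V : State m → ℝ≥0∞) (x : State m)
    (μ : Fin N → Measure (Act p)) : ℝ≥0∞ :=
  ENNReal.ofReal (quadForm (G.Q i t.castSucc) x)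
    + (∫⁻ u, ENNReal.ofReal (quadForm (G.R i t) u) ∂(μ i)
      + ENNReal.ofReal G.τ * InformationTheory.klDiv (μ i) (stdGaussian (Act p)))
    + ∫⁻ a, ∫⁻ w, V (G.step t x a w) ∂(multivariateGaussian 0 G.W) ∂(Measure.pi μ)

/-- The quadratic cost-to-go `yᵀ P y + r`. -/
def quadCost (P : Matrix (Fin m) (Fin m) ℝ) (r : ℝ) (y : State m) : ℝ≥0∞ :=
  ENNReal.ofReal (quadForm P y + r)

/-- The expected next state, without the contribution of agent `i`, when `d` lists the mean actions
of the agents. -/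
def othersDrift (i : Fin N) (t : Fin T) (x : State m) (d : Fin N → Act p) : State m :=
  (G.A t).toEuclideanLin x + ∑ j ∈ Finset.univ.erase i, (G.B j t).toEuclideanLin (d j)

/-- The mean of the best response of agent `i` to the mean actions `d` of the other agents. -/
def responseMean (i : Fin N) (t : Fin T) (P : Matrix (Fin m) (Fin m) ℝ) (x : State m)
    (d : Fin N → Act p) : Act p :=
  -((G.gainMatrix i t P)⁻¹ * ((G.B i t)ᵀ * P)).toEuclideanLin (G.othersDrift i t x d)

/-- The covariance of the best response of agent `i`. -/
def responseCov (i : Fin N) (t : Fin T) (P : Matrix (Fin m) (Fin m) ℝ) :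
    Matrix (Fin p) (Fin p) ℝ :=
  (G.τ / 2) • (G.gainMatrix i t P)⁻¹

theorem posDef_gainMatrix (i : Fin N) (t : Fin T) {P : Matrix (Fin m) (Fin m) ℝ}
    (hP : P.PosSemidef) : (G.gainMatrix i t P).PosDef := by
  have h1 : ((G.τ / 2) • (1 : Matrix (Fin p) (Fin p) ℝ)).PosDef :=
    Matrix.PosDef.one.smul (by have := G.τ_pos; positivity)
  have h2 : ((G.B i t)ᵀ * P * G.B i t).PosSemidef := by
    simpa using hP.conjTranspose_mul_mul_same (G.B i t)
  exact (h1.add (G.R_posDef i t)).add_posSemidef h2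

theorem posDef_responseCov (i : Fin N) (t : Fin T) {P : Matrix (Fin m) (Fin m) ℝ}
    (hP : P.PosSemidef) : (G.responseCov i t P).PosDef :=
  (G.posDef_gainMatrix i t hP).inv.smul (by have := G.τ_pos; positivity)

/-- The noisy part of the next state, as a random vector on the product of the action spaces and the noise
space, is square integrable, and the noise does not contribute to its mean. -/
theorem memLp_sum_add_noise (t : Fin T) (s : Finset (Fin N)) (μ : Fin N → Measure (Act p))
    [∀ j, IsProbabilityMeasure (μ j)] (hμ : ∀ j, MemLp id 2 (μ j)) :
    MemLp (fun z : (Fin N → Act p) × State m =>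
        ∑ j ∈ s, (G.B j t).toEuclideanLin (z.1 j) + z.2) 2
      ((Measure.pi μ).prod (multivariateGaussian (0 : State m) G.W)) ∧
    ∫ z : (Fin N → Act p) × State m, (∑ j ∈ s, (G.B j t).toEuclideanLin (z.1 j) + z.2)
        ∂((Measure.pi μ).prod (multivariateGaussian (0 : State m) G.W))
      = ∑ j ∈ s, (G.B j t).toEuclideanLin (∫ u, u ∂(μ j)) := by
  set ρ := (Measure.pi μ).prod (multivariateGaussian (0 : State m) G.W)
  have he : ∀ j, MeasurePreserving (fun z : (Fin N → Act p) × State m => z.1 j) ρ (μ j) :=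
    fun j => (measurePreserving_eval μ j).comp measurePreserving_fst
  have ha : ∀ j, MemLp (fun z : (Fin N → Act p) × State m => z.1 j) 2 ρ := fun j =>
    (hμ j).comp_measurePreserving (he j)
  have hBa : ∀ j, MemLp (fun z : (Fin N → Act p) × State m => (G.B j t).toEuclideanLin (z.1 j)) 2
      ρ := fun j => (LinearMap.toContinuousLinearMap (G.B j t).toEuclideanLin).comp_memLp' (ha j)
  have hw' : MeasurePreserving (fun z : (Fin N → Act p) × State m => z.2) ρ
    (multivariateGaussian (0 : State m) G.W) := measurePreserving_snd
  have hw : MemLp (fun z : (Fin N → Act p) × State m => z.2) 2 ρ :=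
    (IsGaussian.memLp_two_id).comp_measurePreserving hw'
  have hsum : MemLp (fun z : (Fin N → Act p) × State m =>
      ∑ j ∈ s, (G.B j t).toEuclideanLin (z.1 j)) 2 ρ :=
    memLp_finsetSum _ fun j _ => hBa j
  refine ⟨hsum.add hw, ?_⟩
  have e1 : ∀ j, ∫ z, (G.B j t).toEuclideanLin (z.1 j) ∂ρ
      = (G.B j t).toEuclideanLin (∫ u, u ∂(μ j)) := by
    intro j
    have h2 := (LinearMap.toContinuousLinearMap (G.B j t).toEuclideanLin).integral_comp_comm
      ((ha j).integrable (by norm_num))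
    simp only [LinearMap.coe_toContinuousLinearMap'] at h2
    rw [h2, ← (he j).map_eq, integral_map (he j).measurable.aemeasurable (by fun_prop)]
  have e2 : ∫ z : (Fin N → Act p) × State m, z.2 ∂ρ = 0 := by
    have h2 := integral_id_multivariateGaussian (μ := (0 : State m)) (S := G.W)
    rw [← hw'.map_eq, integral_map hw'.measurable.aemeasurable (by fun_prop)] at h2
    exact h2
  rw [integral_add (hsum.integrable (by norm_num)) (hw.integrable (by norm_num)), e2,
    add_zero, integral_finsetSum _ fun j _ => (hBa j).integrable (by norm_num)]
  exact Finset.sum_congr rfl fun j _ => e1 j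

/-- Against opponents with square-integrable actions, the cost of agent `i` is the free energy of
its own action law for a quadratic potential, and depends on the opponents, up to the constant
`c`, through their mean actions only. -/
theorem exists_stageValue_update_eq (i : Fin N) (t : Fin T) {P : Matrix (Fin m) (Fin m) ℝ}
    (hP : P.PosSemidef) {r : ℝ} (hr : 0 ≤ r) (x : State m) (μ : Fin N → Measure (Act p))
    [∀ j, IsProbabilityMeasure (μ j)] (hμ : ∀ j, MemLp id 2 (μ j)) :
    ∃ c, 0 ≤ c ∧ ∀ (ν : Measure (Act p)) [IsProbabilityMeasure ν],
      G.stageValue i t (quadCost P r) x (Function.update μ i ν)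
        = ENNReal.ofReal (quadForm (G.Q i t.castSucc) x)
          + freeEnergy (stdGaussian (Act p)) G.τ (fun u => quadForm (G.R i t) u + (quadForm P
            (G.othersDrift i t x (fun j => ∫ u, u ∂(μ j)) + (G.B i t).toEuclideanLin u) + c)) ν := by
  obtain ⟨hZ, hmean⟩ := G.memLp_sum_add_noise t (Finset.univ.erase i) μ hμ
  set Z : (Fin N → Act p) × State m → State m := fun z =>
    ∑ j ∈ Finset.univ.erase i, (G.B j t).toEuclideanLin (z.1 j) + z.2 with hZdef
  have hcont : ∀ j, Continuous (G.B j t).toEuclideanLin := fun j =>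
    LinearMap.continuous_of_finiteDimensional _
  obtain ⟨c, hc, hquad⟩ := exists_lintegral_quadForm_add hZ hP hr
  refine ⟨c, hc, fun ν _ => ?_⟩
  have hnext : ∫⁻ a, ∫⁻ w, quadCost P r (G.step t x a w) ∂(multivariateGaussian 0 G.W)
        ∂(Measure.pi (Function.update μ i ν))
      = ∫⁻ u, ENNReal.ofReal (quadForm P (G.othersDrift i t x (fun j => ∫ u, u ∂(μ j))
        + (G.B i t).toEuclideanLin u) + c) ∂ν := by
    -- integrate over the actions of agent `i` last
    have hstep : Continuous fun z : (Fin N → Act p) × State m => G.step t x z.1 z.2 := by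
      unfold step; fun_prop
    have hq : Measurable (quadCost (m := m) P r) := by unfold quadCost; fun_prop
    have hm1 : Measurable fun z : (Fin N → Act p) × State m => quadCost P r (G.step t x z.1 z.2) :=
      hq.comp hstep.measurable
    have hm2 := measurable_update_prod (X := Act p) i
    have hm3 := hm1.lintegral_prod_right' (ν := multivariateGaussian 0 G.W)
    rw [Measure.pi_update_eq_map, lintegral_map hm3 hm2]
    refine (lintegral_prod _ (hm3.comp hm2).aemeasurable).trans ?_
    refine lintegral_congr fun u => ?_
    have hm4 : Measurable fun z : (Fin N → Act p) × State m =>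
        quadCost P r (G.step t x (Function.update z.1 i u) z.2) := by
      refine hm1.comp (g := fun z : (Fin N → Act p) × State m =>
        (quadCost P r (G.step t x z.1 z.2))) (f := fun z : (Fin N → Act p) × State m =>
        (Function.update z.1 i u, z.2)) ?_
      exact (hm2.comp (measurable_const.prodMk measurable_fst)).prodMk measurable_snd
    change ∫⁻ a, ∫⁻ w, quadCost P r (G.step t x (Function.update a i u) w) ∂_ ∂_ = _
    rw [← lintegral_prod (fun z : (Fin N → Act p) × State m =>
      quadCost P r (G.step t x (Function.update z.1 i u) z.2)) hm4.aemeasurable]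
    have := hquad ((G.A t).toEuclideanLin x + (G.B i t).toEuclideanLin u)
    rw [hmean] at this
    convert this using 2
    · ext z
      simp only [quadCost, step, hZdef]
      rw [← Finset.add_sum_erase _ _ (Finset.mem_univ i), Function.update_self,
        Finset.sum_congr rfl (g := fun j => (G.B j t).toEuclideanLin (z.1 j)) fun j hj => by
          rw [Function.update_of_ne (Finset.ne_of_mem_erase hj)]]
      congr 3
      abel
    · congr 2
      unfold othersDrift
      abel
  have hmR : Measurable fun u : Act p => ENNReal.ofReal (quadForm (G.R i t) u) := by fun_prop
  unfold stageValue freeEnergy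
  rw [hnext, Function.update_self, add_assoc]
  congr 1
  rw [add_right_comm, ← lintegral_add_left hmR]
  congr 2
  ext u
  rw [ENNReal.ofReal_add (quadForm_nonneg (G.R_posDef i t).posSemidef _)]
  have := quadForm_nonneg hP (G.othersDrift i t x (fun j => ∫ u, u ∂(μ j))
        + (G.B i t).toEuclideanLin u)
  positivity

/-- The Gibbs measure of the one-stage problem is the Gaussian best response. -/
theorem stdGaussian_tilted_eq_response (i : Fin N) (t : Fin T) {P : Matrix (Fin m) (Fin m) ℝ}
    (hP : P.PosSemidef) (x : State m) (d : Fin N → Act p) (c : ℝ) :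
    (stdGaussian (Act p)).tilted (fun u => -(quadForm (G.R i t) u
        + (quadForm P (G.othersDrift i t x d + (G.B i t).toEuclideanLin u) + c)) / G.τ)
      = multivariateGaussian (G.responseMean i t P x d) (G.responseCov i t P) := by
  set y := G.othersDrift i t x d
  have hG : G.gainMatrix i t P
      = (G.τ / 2) • (1 : Matrix (Fin p) (Fin p) ℝ) + (G.R i t + (G.B i t)ᵀ * P * G.B i t) := by
    rw [gainMatrix, add_assoc]
  have hpd := G.posDef_gainMatrix i t hP
  have hPs : Pᵀ = P := by simpa using hP.isHermitian.eq
  have hu : IsUnit (G.gainMatrix i t P).det := (Matrix.isUnit_iff_isUnit_det _).1 hpd.isUnit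
  have h := stdGaussian_tilted_eq G.τ_pos (hG ▸ hpd) (((G.B i t)ᵀ * P).toEuclideanLin y)
    (G.responseMean i t P x d) (quadForm P y + c) (by
      rw [← hG, responseMean, ← map_neg, Matrix.toLpLin_apply, Matrix.toLpLin_apply]
      simp only [WithLp.ofLp_neg, Matrix.mulVec_neg, Matrix.mulVec_mulVec]
      rw [Matrix.mul_nonsing_inv_cancel_left _ _ hu])
  rw [responseCov, hG, ← h]
  congr 1
  ext u
  have h1 : quadForm P (y + (G.B i t).toEuclideanLin u) = quadForm P y
      + 2 * ((((G.B i t)ᵀ * P).toEuclideanLin y).ofLp ⬝ᵥ u.ofLp)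
      + quadForm ((G.B i t)ᵀ * P * G.B i t) u := by
    have h2 := quadForm_sub hPs ((G.B i t).toEuclideanLin u) (-y)
    rw [quadForm_toEuclideanLin, sub_neg_eq_add, add_comm ((G.B i t).toEuclideanLin u)] at h2
    rw [h2]
    have h3 : quadForm P (-y) = quadForm P y := by simp [quadForm, Matrix.mulVec_neg]
    have h4 : ((G.B i t).toEuclideanLin u).ofLp ⬝ᵥ P *ᵥ (-y).ofLp
        = -((((G.B i t)ᵀ * P).toEuclideanLin y).ofLp ⬝ᵥ u.ofLp) := by
      simp only [Matrix.toLpLin_apply, WithLp.ofLp_neg, Matrix.mulVec_neg, dotProduct_neg,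
        ← Matrix.mulVec_mulVec]
      rw [dotProduct_comm, Matrix.dotProduct_mulVec, Matrix.mulVec_transpose]
    rw [h3, h4]
    ring
  rw [h1, quadForm_add_matrix]
  ring

/-- The best response of agent `i` in the one-stage game, when the opponents play `μ`. -/
def response (i : Fin N) (t : Fin T) (P : Matrix (Fin m) (Fin m) ℝ) (x : State m)
    (μ : Fin N → Measure (Act p)) : Measure (Act p) :=
  multivariateGaussian (G.responseMean i t P x fun j => ∫ u, u ∂(μ j)) (G.responseCov i t P)

instance (i : Fin N) (t : Fin T) (P : Matrix (Fin m) (Fin m) ℝ) (x : State m)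
    (μ : Fin N → Measure (Act p)) : IsProbabilityMeasure (G.response i t P x μ) := by
  unfold response; infer_instance

/-- The best response has finite cost and is the unique minimizer of the cost of agent `i`. -/
theorem stageValue_response (i : Fin N) (t : Fin T) {P : Matrix (Fin m) (Fin m) ℝ}
    (hP : P.PosSemidef) {r : ℝ} (hr : 0 ≤ r) (x : State m) (μ : Fin N → Measure (Act p))
    [∀ j, IsProbabilityMeasure (μ j)] (hμ : ∀ j, MemLp id 2 (μ j))
    (ν : Measure (Act p)) [IsProbabilityMeasure ν] :
    G.stageValue i t (quadCost P r) x (Function.update μ i (G.response i t P x μ)) ≠ ∞ ∧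
    G.stageValue i t (quadCost P r) x (Function.update μ i (G.response i t P x μ))
      ≤ G.stageValue i t (quadCost P r) x (Function.update μ i ν) ∧
    (G.stageValue i t (quadCost P r) x (Function.update μ i ν)
      ≤ G.stageValue i t (quadCost P r) x (Function.update μ i (G.response i t P x μ)) →
      ν = G.response i t P x μ) := by
  obtain ⟨c, hc, h⟩ := G.exists_stageValue_update_eq i t hP hr x μ hμ
  have hcont : Continuous (G.B i t).toEuclideanLin := LinearMap.continuous_of_finiteDimensional _
  set f : Act p → ℝ := fun u => quadForm (G.R i t) u + (quadForm P
    (G.othersDrift i t x (fun j => ∫ u, u ∂(μ j)) + (G.B i t).toEuclideanLin u) + c)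
  have hf : Measurable f := by fun_prop
  have hf0 : ∀ u, 0 ≤ f u := fun u => by
    have h1 := quadForm_nonneg (G.R_posDef i t).posSemidef u
    have h2 := quadForm_nonneg hP
      (G.othersDrift i t x (fun j => ∫ u, u ∂(μ j)) + (G.B i t).toEuclideanLin u)
    positivity
  have hresp : G.response i t P x μ = (stdGaussian (Act p)).tilted fun u => -f u / G.τ :=
    (G.stdGaussian_tilted_eq_response i t hP x _ c).symm
  rw [h, h, hresp]
  refine ⟨?_, ?_, fun hle => ?_⟩
  · exact ENNReal.add_ne_top.2 ⟨ENNReal.ofReal_ne_top, freeEnergy_gibbs_ne_top G.τ_pos hf hf0⟩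
  · gcongr
    exact freeEnergy_gibbs_le G.τ_pos hf hf0 ν
  · exact eq_gibbs_of_freeEnergy_le G.τ_pos hf hf0
      ((ENNReal.add_le_add_iff_left ENNReal.ofReal_ne_top).1 hle)

/-! ### Linear Gaussian play and the Riccati equations -/

/-- The matrix of the quadratic cost-to-go of agent `i` at time `t`, when the agents play linear
Gaussian policies with gains `K` and the cost-to-go at time `t + 1` has the matrix `P`. -/
def evalMatrix (i : Fin N) (t : Fin T) (P : Matrix (Fin m) (Fin m) ℝ)
    (K : Fin N → Matrix (Fin p) (Fin m) ℝ) : Matrix (Fin m) (Fin m) ℝ :=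
  G.Q i t.castSucc + (K i)ᵀ * G.R i t * K i + (G.τ / 2) • ((K i)ᵀ * K i)
    + (G.A t + ∑ j, G.B j t * K j)ᵀ * P * (G.A t + ∑ j, G.B j t * K j)

theorem posSemidef_evalMatrix (i : Fin N) (t : Fin T) {P : Matrix (Fin m) (Fin m) ℝ}
    (hP : P.PosSemidef) (K : Fin N → Matrix (Fin p) (Fin m) ℝ) :
    (G.evalMatrix i t P K).PosSemidef := by
  have h1 : ((K i)ᵀ * G.R i t * K i).PosSemidef := by
    simpa using (G.R_posDef i t).posSemidef.conjTranspose_mul_mul_same (K i)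
  have h2 : ((G.τ / 2) • ((K i)ᵀ * K i)).PosSemidef := by
    refine Matrix.PosSemidef.smul ?_ (by have := G.τ_pos; positivity)
    simpa using Matrix.posSemidef_conjTranspose_mul_self (K i)
  have h3 := hP.conjTranspose_mul_mul_same (G.A t + ∑ j, G.B j t * K j)
  rw [Matrix.conjTranspose_eq_transpose_of_trivial] at h3
  exact (((G.Q_posSemidef i t.castSucc).add h1).add h2).add h3

theorem toEuclideanLin_closedLoop (t : Fin T) (s : Finset (Fin N))
    (K : Fin N → Matrix (Fin p) (Fin m) ℝ) (x : State m) :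
    (G.A t + ∑ j ∈ s, G.B j t * K j).toEuclideanLin x
      = (G.A t).toEuclideanLin x
        + ∑ j ∈ s, (G.B j t).toEuclideanLin ((K j).toEuclideanLin x) := by
  rw [map_add, LinearMap.add_apply, map_sum, LinearMap.sum_apply]
  congr 1
  refine Finset.sum_congr rfl fun j _ => ?_
  simp only [Matrix.toLpLin_apply, Matrix.mulVec_mulVec]

/-- Policy evaluation: linear Gaussian play turns a quadratic cost-to-go into a quadratic one. The
covariances only enter through the constant. -/
theorem exists_stageValue_gaussian (i : Fin N) (t : Fin T) {P : Matrix (Fin m) (Fin m) ℝ}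
    (hP : P.PosSemidef) {r : ℝ} (hr : 0 ≤ r) (K : Fin N → Matrix (Fin p) (Fin m) ℝ)
    {S : Fin N → Matrix (Fin p) (Fin p) ℝ} (hS : (S i).PosDef) :
    ∃ r', 0 ≤ r' ∧ ∀ x, G.stageValue i t (quadCost P r) x
        (fun j => multivariateGaussian ((K j).toEuclideanLin x) (S j))
      = quadCost (G.evalMatrix i t P K) r' x := by
  -- `Z` collects the centered noises of the actions and of the transition
  obtain ⟨hZ, hmean⟩ := G.memLp_sum_add_noise t Finset.univ
    (fun j => multivariateGaussian (0 : Act p) (S j)) fun j => IsGaussian.memLp_two_id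
  set Z : (Fin N → Act p) × State m → State m := fun z =>
    ∑ j, (G.B j t).toEuclideanLin (z.1 j) + z.2 with hZdef
  simp only [integral_id_multivariateGaussian, map_zero, Finset.sum_const_zero] at hmean
  have hcont : ∀ j, Continuous (G.B j t).toEuclideanLin := fun j =>
    LinearMap.continuous_of_finiteDimensional _
  obtain ⟨c, hc, hquad⟩ := exists_lintegral_quadForm_add hZ hP hr
  obtain ⟨cR, hcR, hR⟩ := exists_lintegral_quadForm_add
    (IsGaussian.memLp_two_id (μ := multivariateGaussian (0 : Act p) (S i)))
    (G.R_posDef i t).posSemidef le_rfl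
  obtain ⟨cK, hK⟩ := klDiv_multivariateGaussian hS
  have hcK : 0 ≤ cK := by simpa using (hK 0).1
  have hτ := G.τ_pos
  refine ⟨cR + G.τ * cK + c, by positivity, fun x => ?_⟩
  have hshift : ∀ j, multivariateGaussian ((K j).toEuclideanLin x) (S j)
      = (multivariateGaussian (0 : Act p) (S j)).map fun ξ => (K j).toEuclideanLin x + ξ :=
    fun j => multivariateGaussian_eq_map_add _ _
  have hnext : ∫⁻ a, ∫⁻ w, quadCost P r (G.step t x a w) ∂(multivariateGaussian 0 G.W)
        ∂(Measure.pi fun j => multivariateGaussian ((K j).toEuclideanLin x) (S j))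
      = ENNReal.ofReal (quadForm P ((G.A t + ∑ j, G.B j t * K j).toEuclideanLin x) + c) := by
    have hstep : Continuous fun z : (Fin N → Act p) × State m => G.step t x z.1 z.2 := by
      unfold step; fun_prop
    have hq : Measurable (quadCost (m := m) P r) := by unfold quadCost; fun_prop
    have hm1 : Measurable fun z : (Fin N → Act p) × State m => quadCost P r (G.step t x z.1 z.2) :=
      hq.comp hstep.measurable
    have hm3 := hm1.lintegral_prod_right' (ν := multivariateGaussian 0 G.W)
    have hm2 : Measurable fun (ξ : Fin N → Act p) j => (K j).toEuclideanLin x + ξ j := by fun_prop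
    have hpi : (Measure.pi fun j => multivariateGaussian ((K j).toEuclideanLin x) (S j))
        = (Measure.pi fun j => multivariateGaussian (0 : Act p) (S j)).map
          fun ξ j => (K j).toEuclideanLin x + ξ j := by
      have hpr : ∀ j, SigmaFinite ((multivariateGaussian (0 : Act p) (S j)).map
          fun ξ => (K j).toEuclideanLin x + ξ) := fun j => by rw [← hshift]; infer_instance
      rw [Measure.pi_map_pi (f := fun j ξ => (K j).toEuclideanLin x + ξ) fun j => by fun_prop]
      exact congrArg Measure.pi (funext hshift)
    rw [hpi, lintegral_map hm3 hm2]
    have hstep' : Continuous fun z : (Fin N → Act p) × State m =>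
        G.step t x (fun j => (K j).toEuclideanLin x + z.1 j) z.2 := by
      unfold step; fun_prop
    have hm4 : Measurable fun z : (Fin N → Act p) × State m =>
        quadCost P r (G.step t x (fun j => (K j).toEuclideanLin x + z.1 j) z.2) :=
      hq.comp hstep'.measurable
    refine (lintegral_prod _ hm4.aemeasurable).symm.trans ?_
    have := hquad ((G.A t + ∑ j, G.B j t * K j).toEuclideanLin x)
    rw [hmean, add_zero] at this
    rw [← this]
    refine lintegral_congr fun z => ?_
    rw [quadCost, step, toEuclideanLin_closedLoop]
    simp only [hZdef, map_add, Finset.sum_add_distrib]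
    congr 3
    abel
  have hRi : ∫⁻ u, ENNReal.ofReal (quadForm (G.R i t) u)
        ∂(multivariateGaussian ((K i).toEuclideanLin x) (S i))
      = ENNReal.ofReal (quadForm (G.R i t) ((K i).toEuclideanLin x) + cR) := by
    have := hR ((K i).toEuclideanLin x)
    simp only [id_eq, add_zero, integral_id_multivariateGaussian] at this
    rw [← this, hshift, lintegral_map (by fun_prop) (by fun_prop)]
  have hQ0 := quadForm_nonneg (G.Q_posSemidef i t.castSucc) x
  have hR0 := quadForm_nonneg (G.R_posDef i t).posSemidef ((K i).toEuclideanLin x)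
  have hP0 := quadForm_nonneg hP ((G.A t + ∑ j, G.B j t * K j).toEuclideanLin x)
  have hK0 := (hK ((K i).toEuclideanLin x)).1
  unfold stageValue
  rw [hnext, hRi, (hK _).2, ← ENNReal.ofReal_mul hτ.le, ← ENNReal.ofReal_add (by positivity)
    (by positivity), ← ENNReal.ofReal_add (by positivity) (by positivity),
    ← ENNReal.ofReal_add (by positivity) (by positivity), quadCost, evalMatrix]
  congr 1
  rw [quadForm_add_matrix, quadForm_add_matrix, quadForm_add_matrix, quadForm_smul_matrix,
    ← quadForm_toEuclideanLin, ← quadForm_toEuclideanLin, ← quadForm_one, quadForm_toEuclideanLin 1,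
    Matrix.mul_one]
  ring

/-- With the gain of the Riccati equations, policy evaluation is the Riccati recursion. -/
theorem evalMatrix_eq_riccati (i : Fin N) (t : Fin T) {P : Matrix (Fin m) (Fin m) ℝ}
    (hP : P.PosSemidef) (K : Fin N → Fin T → Matrix (Fin p) (Fin m) ℝ)
    (hK : K i t = -((G.gainMatrix i t P)⁻¹ *
      ((G.B i t)ᵀ * P * G.othersClosedLoop K i t))) :
    G.evalMatrix i t P (fun j => K j t) = G.Q i t.castSucc
      + (G.othersClosedLoop K i t)ᵀ * P * G.othersClosedLoop K i t
      - ((G.B i t)ᵀ * P * G.othersClosedLoop K i t)ᵀ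
        * (G.gainMatrix i t P)⁻¹ * ((G.B i t)ᵀ * P * G.othersClosedLoop K i t) := by
  have hpd := G.posDef_gainMatrix i t hP
  have hu : IsUnit (G.gainMatrix i t P).det := (Matrix.isUnit_iff_isUnit_det _).1 hpd.isUnit
  have hPs : Pᵀ = P := by simpa using hP.isHermitian.eq
  have hcl : G.A t + ∑ j, G.B j t * K j t = G.othersClosedLoop K i t + G.B i t * K i t := by
    rw [othersClosedLoop, ← Finset.add_sum_erase _ _ (Finset.mem_univ i)]
    abel
  rw [evalMatrix, hcl]
  generalize G.othersClosedLoop K i t = A' at *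
  set Y := (G.B i t)ᵀ * P * A' with hY
  have hYt : Yᵀ = A'ᵀ * P * G.B i t := by
    rw [hY]; simp [Matrix.transpose_mul, hPs, Matrix.mul_assoc]
  have hGK : G.gainMatrix i t P * K i t = -Y := by
    rw [hK, Matrix.mul_neg, Matrix.mul_nonsing_inv_cancel_left _ _ hu]
  have hYK : Yᵀ * (G.gainMatrix i t P)⁻¹ * Y = -(Yᵀ * K i t) := by
    rw [hK, Matrix.mul_neg, neg_neg, Matrix.mul_assoc]
  have hKGK : (K i t)ᵀ * G.gainMatrix i t P * K i t = -((K i t)ᵀ * Y) := by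
    rw [Matrix.mul_assoc, hGK, Matrix.mul_neg]
  rw [hYK]
  rw [gainMatrix] at hKGK
  rw [hYt]
  rw [hY] at hKGK
  simp only [Matrix.mul_add, Matrix.add_mul, Matrix.transpose_add, Matrix.transpose_mul,
    Matrix.mul_smul, Matrix.smul_mul, Matrix.mul_one, Matrix.mul_assoc] at hKGK ⊢
  rw [sub_neg_eq_add]
  rw [← sub_eq_zero] at hKGK ⊢
  rw [← hKGK]
  abel

/-! ### The fixed point of the mean responses -/

theorem norm_toEuclideanLin_le {k l : ℕ} (M : Matrix (Fin k) (Fin l) ℝ)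
    (x : EuclideanSpace ℝ (Fin l)) : ‖M.toEuclideanLin x‖ ≤ ‖M‖ * ‖x‖ := by
  have h := Matrix.frobenius_norm_mul M (Matrix.replicateCol Unit x.ofLp)
  rw [← Matrix.replicateCol_mulVec, Matrix.frobenius_norm_replicateCol,
    Matrix.frobenius_norm_replicateCol] at h
  simpa [Matrix.toLpLin_apply] using h

variable {γB γP : ℝ}

/-- Large regularization makes the map of mean responses a contraction. -/
theorem eq_zero_of_mean_response (hB : ∀ i t, ‖G.B i t‖ ≤ γB)
    (hτ : 2 * γB ^ 2 * γP * ((N : ℝ) - 1) < G.τ) (t : Fin T)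
    {P : Fin N → Matrix (Fin m) (Fin m) ℝ} (hP : ∀ i, (P i).PosSemidef)
    (hPγ : ∀ i, ‖P i‖ ≤ γP) {d : Fin N → Act p}
    (hd : ∀ i, d i = -((G.gainMatrix i t (P i))⁻¹ * ((G.B i t)ᵀ * P i)).toEuclideanLin
      (∑ j ∈ Finset.univ.erase i, (G.B j t).toEuclideanLin (d j))) : d = 0 := by
  rcases isEmpty_or_nonempty (Fin N) with hN | hN
  · exact Subsingleton.elim _ _
  -- look at the agent with the largest mean action
  obtain ⟨i, hi⟩ := Finite.exists_max fun j => ‖d j‖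
  set s := ∑ j ∈ Finset.univ.erase i, (G.B j t).toEuclideanLin (d j) with hs
  have hB0 : 0 ≤ γB := (norm_nonneg _).trans (hB i t)
  have hP0 : 0 ≤ γP := (norm_nonneg _).trans (hPγ i)
  have hsn : ‖s‖ ≤ ((N : ℝ) - 1) * (γB * ‖d i‖) := by
    calc ‖s‖ ≤ ∑ j ∈ Finset.univ.erase i, ‖(G.B j t).toEuclideanLin (d j)‖ := norm_sum_le _ _
      _ ≤ ∑ j ∈ Finset.univ.erase i, γB * ‖d i‖ := by
        refine Finset.sum_le_sum fun j _ => (norm_toEuclideanLin_le _ _).trans ?_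
        gcongr
        exacts [hB j t, hi j]
      _ = _ := by
        rw [Finset.sum_const, Finset.card_erase_of_mem (Finset.mem_univ i), Finset.card_univ,
          Fintype.card_fin, nsmul_eq_mul, Nat.cast_sub (by have := i.pos; omega), Nat.cast_one]
  have hpd := G.posDef_gainMatrix i t (hP i)
  have hu : IsUnit (G.gainMatrix i t (P i)).det := (Matrix.isUnit_iff_isUnit_det _).1 hpd.isUnit
  have hGd : (G.gainMatrix i t (P i)).toEuclideanLin (d i)
      = -((G.B i t)ᵀ.toEuclideanLin ((P i).toEuclideanLin s)) := by
    rw [hd i, ← hs]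
    simp only [map_neg, Matrix.toLpLin_apply, Matrix.mulVec_mulVec]
    rw [Matrix.mul_nonsing_inv_cancel_left _ _ hu]
  have hlow : G.τ / 2 * ‖d i‖ ^ 2
      ≤ inner ℝ (d i) ((G.gainMatrix i t (P i)).toEuclideanLin (d i)) := by
    have h1 : inner ℝ (d i) ((G.gainMatrix i t (P i)).toEuclideanLin (d i))
        = quadForm (G.gainMatrix i t (P i)) (d i) := (quadForm_eq_inner _ _).symm
    have h2 := quadForm_nonneg (G.R_posDef i t).posSemidef (d i)
    have h3 := quadForm_nonneg (hP i) ((G.B i t).toEuclideanLin (d i))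
    rw [quadForm_toEuclideanLin] at h3
    rw [h1, gainMatrix, quadForm_add_matrix, quadForm_add_matrix, quadForm_smul_matrix,
      quadForm_one]
    linarith
  have hup : inner ℝ (d i) ((G.gainMatrix i t (P i)).toEuclideanLin (d i))
      ≤ ‖d i‖ * (γB * (γP * (((N : ℝ) - 1) * (γB * ‖d i‖)))) := by
    refine (real_inner_le_norm _ _).trans ?_
    rw [hGd, norm_neg]
    gcongr
    refine (norm_toEuclideanLin_le _ _).trans ?_
    rw [Matrix.frobenius_norm_transpose]
    gcongr
    · exact hB i t
    · refine (norm_toEuclideanLin_le _ _).trans ?_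
      gcongr
      exact hPγ i
  have hzero : ‖d i‖ = 0 := by
    by_contra hne
    have hpos : 0 < ‖d i‖ ^ 2 := by positivity
    have := hlow.trans hup
    nlinarith
  ext1 j
  exact norm_le_zero_iff.1 (hzero ▸ hi j)

theorem responseMean_eq (i : Fin N) (t : Fin T) (P : Matrix (Fin m) (Fin m) ℝ) (x : State m)
    (d : Fin N → Act p) : G.responseMean i t P x d
      = -((G.gainMatrix i t P)⁻¹ * ((G.B i t)ᵀ * P)).toEuclideanLin ((G.A t).toEuclideanLin x)
      + -((G.gainMatrix i t P)⁻¹ * ((G.B i t)ᵀ * P)).toEuclideanLin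
        (∑ j ∈ Finset.univ.erase i, (G.B j t).toEuclideanLin (d j)) := by
  rw [responseMean, othersDrift, map_add, neg_add]

theorem responseMean_fixed_unique (hB : ∀ i t, ‖G.B i t‖ ≤ γB)
    (hτ : 2 * γB ^ 2 * γP * ((N : ℝ) - 1) < G.τ) (t : Fin T)
    {P : Fin N → Matrix (Fin m) (Fin m) ℝ} (hP : ∀ i, (P i).PosSemidef)
    (hPγ : ∀ i, ‖P i‖ ≤ γP) (x : State m) {d d' : Fin N → Act p}
    (hd : ∀ i, d i = G.responseMean i t (P i) x d)
    (hd' : ∀ i, d' i = G.responseMean i t (P i) x d') : d = d' := by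
  rw [← sub_eq_zero]
  refine G.eq_zero_of_mean_response hB hτ t hP hPγ fun i => ?_
  rw [Pi.sub_apply, hd i, hd' i, responseMean_eq, responseMean_eq]
  simp only [Pi.sub_apply, map_sub, Finset.sum_sub_distrib]
  abel

/-- The fixed point of the mean responses is linear in the state. -/
theorem exists_gain (hB : ∀ i t, ‖G.B i t‖ ≤ γB)
    (hτ : 2 * γB ^ 2 * γP * ((N : ℝ) - 1) < G.τ) (t : Fin T)
    {P : Fin N → Matrix (Fin m) (Fin m) ℝ} (hP : ∀ i, (P i).PosSemidef)
    (hPγ : ∀ i, ‖P i‖ ≤ γP) :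
    ∃ K : Fin N → Matrix (Fin p) (Fin m) ℝ, ∀ i, K i = -((G.gainMatrix i t (P i))⁻¹ *
      ((G.B i t)ᵀ * P i * (G.A t + ∑ j ∈ Finset.univ.erase i, G.B j t * K j))) := by
  let M : Fin N → Matrix (Fin p) (Fin m) ℝ := fun i =>
    (G.gainMatrix i t (P i))⁻¹ * ((G.B i t)ᵀ * P i)
  let Φ : (Fin N → Act p) →ₗ[ℝ] (Fin N → Act p) := LinearMap.pi fun i =>
    LinearMap.proj i + (M i).toEuclideanLin ∘ₗ
      ∑ j ∈ Finset.univ.erase i, (G.B j t).toEuclideanLin ∘ₗ LinearMap.proj j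
  have hΦ : ∀ d i, Φ d i = d i + (M i).toEuclideanLin
      (∑ j ∈ Finset.univ.erase i, (G.B j t).toEuclideanLin (d j)) := by
    intro d i; simp [Φ, LinearMap.sum_apply]
  have hinj : Function.Injective Φ := by
    rw [injective_iff_map_eq_zero]
    intro d hd
    refine G.eq_zero_of_mean_response hB hτ t hP hPγ fun i => ?_
    have := congrFun hd i
    rw [hΦ] at this
    exact eq_neg_of_add_eq_zero_left this
  let e := LinearEquiv.ofInjectiveEndo Φ hinj
  let κ : State m →ₗ[ℝ] (Fin N → Act p) := e.symm.toLinearMap ∘ₗ LinearMap.pi fun i =>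
    -((M i).toEuclideanLin ∘ₗ (G.A t).toEuclideanLin)
  have hκ : ∀ x i, κ x i = -(M i).toEuclideanLin ((G.A t).toEuclideanLin x
      + ∑ j ∈ Finset.univ.erase i, (G.B j t).toEuclideanLin (κ x j)) := by
    intro x i
    have h1 : Φ (κ x) i = -(M i).toEuclideanLin ((G.A t).toEuclideanLin x) := by
      change (e (e.symm _)) i = _
      rw [e.apply_symm_apply]
      rfl
    rw [hΦ] at h1
    rw [map_add, neg_add, ← h1]
    abel
  refine ⟨fun i => Matrix.toEuclideanLin.symm (LinearMap.proj i ∘ₗ κ), fun i => ?_⟩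
  apply Matrix.toEuclideanLin.injective
  ext1 x
  have hK : ∀ j,
      (Matrix.toEuclideanLin.symm (LinearMap.proj j ∘ₗ κ)).toEuclideanLin x = κ x j := by
    intro j; rw [LinearEquiv.apply_symm_apply]; rfl
  rw [hK, hκ, map_neg, LinearMap.neg_apply, ← Matrix.mul_assoc]
  have h2 := G.toEuclideanLin_closedLoop t (Finset.univ.erase i)
    (fun j => Matrix.toEuclideanLin.symm (LinearMap.proj j ∘ₗ κ)) x
  simp only [hK] at h2
  rw [← h2]
  simp only [Matrix.toLpLin_apply, Matrix.mulVec_mulVec]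
  rfl

/-- The coupled Nash Riccati equations are solvable by backward recursion: the bound on partial
solutions makes each step a contraction. -/
theorem exists_isNashRiccati (hB : ∀ i t, ‖G.B i t‖ ≤ γB)
    (hP : ∀ t₀ P K, G.IsNashRiccati t₀ P K → ∀ i t, t₀ ≤ t → ‖P i t‖ ≤ γP)
    (hτ : 2 * γB ^ 2 * γP * ((N : ℝ) - 1) < G.τ) :
    ∃ P K, G.IsNashRiccati 0 P K ∧ ∀ i t, (P i t).PosSemidef := by
  suffices h : ∀ t₀ : Fin (T + 1), ∃ P K, G.IsNashRiccati t₀ P K ∧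
      ∀ i t, t₀ ≤ t → (P i t).PosSemidef by
    obtain ⟨P, K, h1, h2⟩ := h 0
    exact ⟨P, K, h1, fun i t => h2 i t (Fin.zero_le _)⟩
  intro t₀
  induction t₀ using Fin.reverseInduction with
  | last =>
    refine ⟨G.Q, 0, ⟨fun i => rfl, fun t ht => ?_⟩, fun i t _ => G.Q_posSemidef i t⟩
    exact absurd (Fin.castSucc_lt_last t) (not_lt.2 ht)
  | cast t ih =>
    obtain ⟨P, K, hR, hpsd⟩ := ih
    have hpsd' : ∀ i, (P i t.succ).PosSemidef := fun i => hpsd i t.succ le_rfl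
    obtain ⟨k, hk⟩ := G.exists_gain hB hτ t hpsd' fun i => hP _ P K hR i t.succ le_rfl
    let K' : Fin N → Fin T → Matrix (Fin p) (Fin m) ℝ := fun i => Function.update (K i) t (k i)
    let P' : Fin N → Fin (T + 1) → Matrix (Fin m) (Fin m) ℝ := fun i =>
      Function.update (P i) t.castSucc (G.evalMatrix i t (P i t.succ) k)
    have hPs : ∀ i (s : Fin (T + 1)), t.castSucc < s → P' i s = P i s := fun i s hs =>
      Function.update_of_ne hs.ne' _ _
    have hKt : ∀ i, K' i t = k i := fun i => Function.update_self _ _ _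
    have hPt : ∀ i, P' i t.castSucc = G.evalMatrix i t (P i t.succ) k := fun i =>
      Function.update_self _ _ _
    have hcl : ∀ i, G.othersClosedLoop K' i t
        = G.A t + ∑ j ∈ Finset.univ.erase i, G.B j t * k j := by
      intro i; simp only [othersClosedLoop, hKt]
    refine ⟨P', K', ⟨fun i => ?_, fun s hs i => ?_⟩, fun i s hs => ?_⟩
    · rw [hPs i _ (Fin.castSucc_lt_last t)]
      exact hR.1 i
    · rcases hs.eq_or_lt with heq | hlt
      · obtain rfl : t = s := Fin.castSucc_injective _ heq
        have hK : K' i t = -((G.gainMatrix i t (P i t.succ))⁻¹ *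
            ((G.B i t)ᵀ * P i t.succ * G.othersClosedLoop K' i t)) := by
          rw [hKt, hcl]; exact hk i
        rw [hPs i _ Fin.castSucc_lt_succ, hPt]
        refine ⟨hK, ?_⟩
        rw [← G.evalMatrix_eq_riccati i t (hpsd' i) K' hK]
        simp only [hKt]
      · have hst : t < s := hlt
        have hcl' : G.othersClosedLoop K' i s = G.othersClosedLoop K i s := by
          simp only [othersClosedLoop, K', Function.update_of_ne hst.ne']
        have hs' : t.succ ≤ s.castSucc := Fin.succ_le_castSucc_iff.2 hst
        rw [hPs i _ hlt, hPs i _ (hlt.trans Fin.castSucc_lt_succ), hcl']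
        have : K' i s = K i s := Function.update_of_ne hst.ne' _ _
        rw [this]
        exact hR.2 s hs' i
    · rcases hs.eq_or_lt with heq | hlt
      · rw [← heq, hPt]
        exact G.posSemidef_evalMatrix i t (hpsd' i) k
      · rw [hPs i s hlt]
        exact hpsd i s (Fin.castSucc_lt_iff_succ_le.1 hlt)

end LQGame

/-! ### Trajectories and policies -/

namespace Traj

variable (ω : Traj N m p T) (t : Fin T) (a : Fin N → Act p) (y : State m)

theorem extend_x_of_ne {s : Fin (T + 1)} (h : s ≠ t.succ) : (ω.extend t a y).x s = ω.x s :=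
  Function.update_of_ne h _ _

theorem extend_x_succ : (ω.extend t a y).x t.succ = y := Function.update_self _ _ _

theorem extend_u_self : (ω.extend t a y).u t = a := Function.update_self _ _ _

theorem extend_u_of_ne {s : Fin T} (h : s ≠ t) : (ω.extend t a y).u s = ω.u s :=
  Function.update_of_ne h _ _

/-- What happens from time `t` on does not affect the information at times up to `t`. -/
theorem extend_info {s : Fin T} (h : s ≤ t) (i : Fin N) :
    (ω.extend t a y).info i s = ω.info i s := by
  refine Prod.ext (funext fun k => ?_) (funext fun k => ?_)
  · refine extend_x_of_ne ω t a y (ne_of_lt (k.2.trans_lt ?_))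
    exact Fin.castSucc_lt_succ_iff.2 h
  · exact congrFun (extend_u_of_ne ω t a y (k.2.trans_le h).ne) i

/-- Every value of the information arises along some trajectory. -/
theorem exists_info_eq (i : Fin N) (I : Info m p T t) : ∃ ω : Traj N m p T, ω.info i t = I := by
  refine ⟨⟨fun s => if h : s ≤ t.castSucc then I.1 ⟨s, h⟩ else 0,
    fun s _ => if h : s < t then I.2 ⟨s, h⟩ else 0⟩, ?_⟩
  refine Prod.ext (funext fun k => ?_) (funext fun k => ?_)
  · exact dif_pos k.2
  · exact dif_pos k.2

end Traj

namespace Policy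

/-- The kernel `N(K x_t, S)`. -/
def gaussianKernel (t : Fin T) (K : Matrix (Fin p) (Fin m) ℝ) (S : Matrix (Fin p) (Fin p) ℝ) :
    Kernel (Info m p T t) (Act p) where
  toFun I := multivariateGaussian (K.toEuclideanLin (I.1 ⟨t.castSucc, le_rfl⟩)) S
  measurable' := by
    refine Measure.measurable_of_measurable_coe _ fun s hs => ?_
    have hc : Continuous K.toEuclideanLin := LinearMap.continuous_of_finiteDimensional _
    have hm : Measurable fun z : Info m p T t × Act p =>
        K.toEuclideanLin (z.1.1 ⟨t.castSucc, le_rfl⟩) + z.2 := by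
      have hx : Measurable fun z : Info m p T t × Act p => z.1.1 ⟨t.castSucc, le_rfl⟩ := by
        fun_prop
      exact (hc.measurable.comp hx).add measurable_snd
    have h := measurable_measure_prodMk_left (ν := multivariateGaussian (0 : Act p) S) (hm hs)
    convert! h using 2 with I
    rw [multivariateGaussian_eq_map_add, Measure.map_apply (by fun_prop) hs]
    rfl

theorem gaussianKernel_apply (t : Fin T) (K : Matrix (Fin p) (Fin m) ℝ)
    (S : Matrix (Fin p) (Fin p) ℝ) (I : Info m p T t) : gaussianKernel t K S I
      = multivariateGaussian (K.toEuclideanLin (I.1 ⟨t.castSucc, le_rfl⟩)) S := rfl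

instance (t : Fin T) (K : Matrix (Fin p) (Fin m) ℝ) (S : Matrix (Fin p) (Fin p) ℝ) :
    IsMarkovKernel (gaussianKernel (m := m) t K S) :=
  ⟨fun I => by rw [gaussianKernel_apply]; infer_instance⟩

/-- The policy `N(K_t x_t, S_t)`. -/
def gaussian (K : Fin T → Matrix (Fin p) (Fin m) ℝ) (S : Fin T → Matrix (Fin p) (Fin p) ℝ) :
    Policy m p T :=
  ⟨fun t => gaussianKernel t (K t) (S t), fun _ => inferInstance⟩

/-- The policy `σ` with its kernel at time `t` replaced by `κ`. -/
def replaceAt (σ : Policy m p T) (t : Fin T) (κ : Kernel (Info m p T t) (Act p))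
    [IsMarkovKernel κ] : Policy m p T :=
  ⟨Function.update σ.kernel t κ, fun s => by
    by_cases h : s = t
    · subst h; simpa
    · simpa [h] using σ.isMarkov s⟩

theorem replaceAt_kernel_self (σ : Policy m p T) (t : Fin T) (κ : Kernel (Info m p T t) (Act p))
    [IsMarkovKernel κ] : (σ.replaceAt t κ).kernel t = κ := Function.update_self _ _ _

theorem replaceAt_kernel_of_ne (σ : Policy m p T) {t s : Fin T} (h : s ≠ t)
    (κ : Kernel (Info m p T t) (Act p)) [IsMarkovKernel κ] :
    (σ.replaceAt t κ).kernel s = σ.kernel s := Function.update_of_ne h _ _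

end Policy

namespace Profile

instance (π : Profile N m p T) (i : Fin N) (t : Fin T) (ω : Traj N m p T) :
    IsProbabilityMeasure (π.actionLaw i t ω) :=
  ((π i).isMarkov t).isProbabilityMeasure _

theorem actionLaw_update (π : Profile N m p T) (i : Fin N) (σ : Policy m p T) (t : Fin T)
    (ω : Traj N m p T) : (fun j => actionLaw (Function.update π i σ) j t ω)
      = Function.update (fun j => π.actionLaw j t ω) i (σ.kernel t (ω.info i t)) := by
  ext1 j
  by_cases h : j = i
  · subst h; simp [actionLaw]
  · simp [actionLaw, h]

theorem actionLaw_update_replaceAt_of_ne (π : Profile N m p T) (i : Fin N) {t s : Fin T}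
    (h : s ≠ t) (κ : Kernel (Info m p T t) (Act p)) [IsMarkovKernel κ] (j : Fin N)
    (ω : Traj N m p T) :
    actionLaw (Function.update π i ((π i).replaceAt t κ)) j s ω = π.actionLaw j s ω := by
  by_cases hj : j = i
  · subst hj; simp [actionLaw, Policy.replaceAt_kernel_of_ne _ h]
  · simp [actionLaw, hj]

theorem actionLaw_extend (π : Profile N m p T) (i : Fin N) {t s : Fin T} (h : s ≤ t)
    (ω : Traj N m p T) (a : Fin N → Act p) (y : State m) :
    π.actionLaw i s (ω.extend t a y) = π.actionLaw i s ω := by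
  rw [actionLaw, actionLaw, Traj.extend_info _ _ _ _ h]

theorem ext_actionLaw {π π' : Profile N m p T}
    (h : ∀ i t ω, π.actionLaw i t ω = π'.actionLaw i t ω) : π = π' := by
  ext1 i
  have hk : (π i).kernel = (π' i).kernel := by
    ext1 t
    ext1 I
    obtain ⟨ω, rfl⟩ := Traj.exists_info_eq t i I
    exact h i t ω
  cases hπ : π i
  cases hπ' : π' i
  simp only [hπ, hπ'] at hk
  subst hk
  rfl

end Profile

namespace LQGame

variable (G : LQGame N m p T)

/-! ### The dynamic programming recursion -/

theorem expect_last (π : Profile N m p T) (F : Traj N m p T → ℝ≥0∞) :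
    G.expect π F (Fin.last T) = F := by
  rw [expect, Fin.reverseInduction_last]

theorem expect_castSucc (π : Profile N m p T) (F : Traj N m p T → ℝ≥0∞) (t : Fin T)
    (ω : Traj N m p T) : G.expect π F t.castSucc ω
      = ∫⁻ a, ∫⁻ w, G.expect π F t.succ (ω.extend t a (G.step t (ω.x t.castSucc) a w))
        ∂(multivariateGaussian 0 G.W) ∂(Measure.pi fun i => π.actionLaw i t ω) := by
  rw [expect, Fin.reverseInduction_castSucc]
  rfl

/-- A quantity that is determined at time `t` can be taken out of the conditional expectation. -/
theorem expect_add_of_determined (π : Profile N m p T) (c F : Traj N m p T → ℝ≥0∞)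
    (t : Fin (T + 1)) (hc : ∀ s : Fin T, t ≤ s.castSucc → ∀ ω a y, c (ω.extend s a y) = c ω)
    (ω : Traj N m p T) :
    G.expect π (fun ω => c ω + F ω) t ω = c ω + G.expect π F t ω := by
  induction t using Fin.reverseInduction generalizing ω with
  | last => simp only [expect_last]
  | cast t ih =>
    have ih' := ih fun s hs => hc s (Fin.castSucc_lt_succ.le.trans hs)
    simp only [expect_castSucc, ih', hc t le_rfl]
    simp only [lintegral_add_left measurable_const, lintegral_const, measure_univ, mul_one]

theorem stageCost_extend_of_lt (π : Profile N m p T) (i : Fin N) {t s : Fin T} (h : t < s)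
    (ω : Traj N m p T) (a : Fin N → Act p) (y : State m) :
    G.stageCost π i t (ω.extend s a y) = G.stageCost π i t ω := by
  have h1 : t.castSucc ≠ s.succ := ne_of_lt (Fin.castSucc_lt_succ_iff.2 h.le)
  rw [stageCost, stageCost, Traj.extend_x_of_ne _ _ _ _ h1, Traj.extend_u_of_ne _ _ _ _ h.ne,
    Profile.actionLaw_extend _ _ h.le]

theorem costToGo_last (π : Profile N m p T) (i : Fin N) (ω : Traj N m p T) :
    G.costToGo π i (Fin.last T) ω = quadCost (G.Q i (Fin.last T)) 0 (ω.x (Fin.last T)) := by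
  have : (Finset.univ.filter fun s : Fin T => Fin.last T ≤ s.castSucc) = ∅ :=
    Finset.filter_false_of_mem fun s _ => not_le.2 (Fin.castSucc_lt_last s)
  rw [costToGo, expect_last, this, Finset.sum_empty, zero_add, quadCost, add_zero]
  rfl

/-- The Bellman recursion for the cost-to-go of a profile. -/
theorem costToGo_castSucc (π : Profile N m p T) (i : Fin N) (t : Fin T) (ω : Traj N m p T) :
    G.costToGo π i t.castSucc ω
      = ENNReal.ofReal (quadForm (G.Q i t.castSucc) (ω.x t.castSucc))
        + (∫⁻ u, ENNReal.ofReal (quadForm (G.R i t) u) ∂(π.actionLaw i t ω)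
          + ENNReal.ofReal G.τ
            * InformationTheory.klDiv (π.actionLaw i t ω) (stdGaussian (Act p)))
        + ∫⁻ a, ∫⁻ w, G.costToGo π i t.succ (ω.extend t a (G.step t (ω.x t.castSucc) a w))
          ∂(multivariateGaussian 0 G.W) ∂(Measure.pi fun j => π.actionLaw j t ω) := by
  have hfilter : (Finset.univ.filter fun s : Fin T => t.castSucc ≤ s.castSucc)
      = insert t (Finset.univ.filter fun s : Fin T => t.succ ≤ s.castSucc) := by
    ext s
    simp only [Finset.mem_filter, Finset.mem_univ, true_and, Finset.mem_insert,
      Fin.castSucc_le_castSucc_iff, Fin.succ_le_castSucc_iff]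
    rw [le_iff_eq_or_lt, eq_comm]
  have hnot : t ∉ Finset.univ.filter fun s : Fin T => t.succ ≤ s.castSucc := by
    simp [Fin.succ_le_castSucc_iff]
  have hstep : ∀ ω', G.expect π (fun ω' => (∑ s : Fin T with t.castSucc ≤ s.castSucc,
      G.stageCost π i s ω') + G.terminalCost i ω') t.succ ω'
      = G.stageCost π i t ω' + G.costToGo π i t.succ ω' := by
    intro ω'
    simp only [hfilter, Finset.sum_insert hnot, add_assoc]
    exact G.expect_add_of_determined π _ _ t.succ
      (fun s hs => G.stageCost_extend_of_lt π i (Fin.succ_le_castSucc_iff.1 hs)) ω'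
  have hcost : ∀ a y, G.stageCost π i t (ω.extend t a y)
      = ENNReal.ofReal (quadForm (G.Q i t.castSucc) (ω.x t.castSucc))
        + ENNReal.ofReal (quadForm (G.R i t) (a i)) + ENNReal.ofReal G.τ
            * InformationTheory.klDiv (π.actionLaw i t ω) (stdGaussian (Act p)) := by
    intro a y
    rw [stageCost, Traj.extend_x_of_ne _ _ _ _ Fin.castSucc_lt_succ.ne, Traj.extend_u_self,
      Profile.actionLaw_extend _ _ le_rfl]
    rfl
  rw [costToGo, expect_castSucc]
  simp only [hstep, hcost]
  simp only [lintegral_add_left measurable_const, lintegral_const, measure_univ, mul_one]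
  have hm : Measurable fun a : Fin N → Act p => ENNReal.ofReal (quadForm (G.R i t) (a i)) := by
    fun_prop
  have he := (measurePreserving_eval (fun j => π.actionLaw j t ω) i).lintegral_comp
    (f := fun u => ENNReal.ofReal (quadForm (G.R i t) u)) (by fun_prop)
  simp only [Function.eval] at he
  simp only [add_assoc]
  rw [lintegral_add_left measurable_const, lintegral_add_left hm,
    lintegral_add_left measurable_const, he]
  simp only [lintegral_const, measure_univ, mul_one]

theorem costToGo_eq_stageValue (π : Profile N m p T) (i : Fin N) (t : Fin T) (ω : Traj N m p T)
    {V : State m → ℝ≥0∞} (h : ∀ a, ∀ᵐ w ∂(multivariateGaussian 0 G.W),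
      G.costToGo π i t.succ (ω.extend t a (G.step t (ω.x t.castSucc) a w))
        = V (G.step t (ω.x t.castSucc) a w)) :
    G.costToGo π i t.castSucc ω
      = G.stageValue i t V (ω.x t.castSucc) fun j => π.actionLaw j t ω := by
  rw [costToGo_castSucc, stageValue]
  congr 1
  exact lintegral_congr fun a => lintegral_congr_ae (h a)

theorem stageValue_le_costToGo (π : Profile N m p T) (i : Fin N) (t : Fin T) (ω : Traj N m p T)
    {V : State m → ℝ≥0∞} (h : ∀ a w, V (G.step t (ω.x t.castSucc) a w)
      ≤ G.costToGo π i t.succ (ω.extend t a (G.step t (ω.x t.castSucc) a w))) :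
    G.stageValue i t V (ω.x t.castSucc) (fun j => π.actionLaw j t ω)
      ≤ G.costToGo π i t.castSucc ω := by
  rw [costToGo_castSucc, stageValue]
  gcongr
  exact h _ _

/-- The sets `L t` of states at time `t` are almost surely never left, whatever the actions. -/
def Invariant (L : Fin (T + 1) → Set (State m)) : Prop :=
  ∀ (t : Fin T), ∀ x ∈ L t.castSucc, ∀ a, ∀ᵐ w ∂(multivariateGaussian 0 G.W),
    G.step t x a w ∈ L t.succ

theorem invariant_univ : G.Invariant fun _ => Set.univ :=
  fun _ _ _ _ => ae_of_all _ fun _ => Set.mem_univ _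

/-- The cost-to-go of a linear Gaussian profile is a quadratic function of the current state. -/
theorem exists_costToGo_eq_quadCost {π : Profile N m p T}
    {K : Fin N → Fin T → Matrix (Fin p) (Fin m) ℝ} {S : Fin N → Fin T → Matrix (Fin p) (Fin p) ℝ}
    (hS : ∀ i t, (S i t).PosDef) (hπ : ∀ i t ω, π.actionLaw i t ω =
      multivariateGaussian ((K i t).toEuclideanLin (ω.x t.castSucc)) (S i t))
    (i : Fin N) (t : Fin (T + 1)) :
    ∃ P r, P.PosSemidef ∧ 0 ≤ r ∧ ∀ ω, G.costToGo π i t ω = quadCost P r (ω.x t) := by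
  induction t using Fin.reverseInduction with
  | last => exact ⟨_, 0, G.Q_posSemidef i (Fin.last T), le_rfl, G.costToGo_last π i⟩
  | cast t ih =>
    obtain ⟨P, r, hP, hr, h⟩ := ih
    obtain ⟨r', hr', h'⟩ := G.exists_stageValue_gaussian i t hP hr (fun j => K j t)
      (S := fun j => S j t) (hS i t)
    refine ⟨_, r', G.posSemidef_evalMatrix i t hP fun j => K j t, hr', fun ω => ?_⟩
    rw [← h', G.costToGo_eq_stageValue π i t ω (V := quadCost P r) fun a => ae_of_all _ fun w => by
      rw [h, Traj.extend_x_succ]]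
    simp only [hπ]

theorem quadCost_ne_top (P : Matrix (Fin m) (Fin m) ℝ) (r : ℝ) (y : State m) :
    quadCost P r y ≠ ∞ := ENNReal.ofReal_ne_top

theorem continuous_quadCost (P : Matrix (Fin m) (Fin m) ℝ) (r : ℝ) :
    Continuous (quadCost P r) :=
  ENNReal.continuous_ofReal.comp ((continuous_quadForm P).add continuous_const)

/-! ### Solutions of the coupled Bellman equations -/

/-- A solution of the coupled Bellman equations of the game: quadratic value functions
`xᵀ P x + r` and gains `K` such that, at every time and state, the mean actions `K x` are the only
ones that are mean best responses to each other, and the values are those of the corresponding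
Gaussian play. -/
structure BellmanSolution where
  P : Fin N → Fin (T + 1) → Matrix (Fin m) (Fin m) ℝ
  K : Fin N → Fin T → Matrix (Fin p) (Fin m) ℝ
  r : Fin N → Fin (T + 1) → ℝ
  P_posSemidef : ∀ i t, (P i t).PosSemidef
  r_nonneg : ∀ i t, 0 ≤ r i t
  P_last : ∀ i, P i (Fin.last T) = G.Q i (Fin.last T)
  r_last : ∀ i, r i (Fin.last T) = 0
  fixed : ∀ i t x, (K i t).toEuclideanLin x
    = G.responseMean i t (P i t.succ) x fun j => (K j t).toEuclideanLin x
  unique : ∀ t x (d : Fin N → Act p), (∀ i, d i = G.responseMean i t (P i t.succ) x d) →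
    ∀ i, d i = (K i t).toEuclideanLin x
  value : ∀ i t x, G.stageValue i t (quadCost (P i t.succ) (r i t.succ)) x
      (fun j => multivariateGaussian ((K j t).toEuclideanLin x) (G.responseCov j t (P j t.succ)))
    = quadCost (P i t.castSucc) (r i t.castSucc) x

/-- Large regularization yields a solution of the coupled Bellman equations. The matrices solve the
coupled Nash Riccati equations, which is why they obey the bound `γP`. -/
theorem nonempty_bellmanSolution {γB γP : ℝ} (hB : ∀ i t, ‖G.B i t‖ ≤ γB)
    (hP : ∀ t₀ P K, G.IsNashRiccati t₀ P K → ∀ i t, t₀ ≤ t → ‖P i t‖ ≤ γP)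
    (hτ : 2 * γB ^ 2 * γP * ((N : ℝ) - 1) < G.τ) : Nonempty G.BellmanSolution := by
  obtain ⟨P, K, hR, hpsd⟩ := G.exists_isNashRiccati hB hP hτ
  have hbd : ∀ i t, ‖P i t‖ ≤ γP := fun i t => hP 0 P K hR i t (Fin.zero_le _)
  have hK := fun t i => (hR.2 t (Fin.zero_le _) i).1
  have hPt : ∀ i t, P i t.castSucc = G.evalMatrix i t (P i t.succ) fun j => K j t := by
    intro i t
    rw [G.evalMatrix_eq_riccati i t (hpsd i t.succ) K (hK t i)]
    exact (hR.2 t (Fin.zero_le _) i).2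
  have hex : ∀ i t (r : {r : ℝ // 0 ≤ r}), ∃ r' : {r : ℝ // 0 ≤ r}, ∀ x,
      G.stageValue i t (quadCost (P i t.succ) r) x (fun j =>
        multivariateGaussian ((K j t).toEuclideanLin x) (G.responseCov j t (P j t.succ)))
      = quadCost (P i t.castSucc) r' x := by
    intro i t r
    obtain ⟨r', h0, h⟩ := G.exists_stageValue_gaussian i t (hpsd i t.succ) r.2 (fun j => K j t)
      (S := fun j => G.responseCov j t (P j t.succ)) (G.posDef_responseCov i t (hpsd i t.succ))
    exact ⟨⟨r', h0⟩, fun x => by rw [h, hPt]⟩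
  choose f hf using hex
  let r : Fin N → Fin (T + 1) → {r : ℝ // 0 ≤ r} := fun i =>
    Fin.reverseInduction (motive := fun _ => {r : ℝ // 0 ≤ r}) ⟨0, le_rfl⟩ fun t => f i t
  have hr0 : ∀ i, r i (Fin.last T) = ⟨0, le_rfl⟩ := fun i => Fin.reverseInduction_last ..
  have hr1 : ∀ i t, r i t.castSucc = f i t (r i t.succ) := fun i t =>
    Fin.reverseInduction_castSucc ..
  have hfix : ∀ i t x, (K i t).toEuclideanLin x
      = G.responseMean i t (P i t.succ) x fun j => (K j t).toEuclideanLin x := by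
    intro i t x
    rw [hK t i, responseMean, othersDrift, othersClosedLoop, ← toEuclideanLin_closedLoop,
      map_neg, LinearMap.neg_apply, ← Matrix.mul_assoc]
    simp only [Matrix.toLpLin_apply, Matrix.mulVec_mulVec]
  exact ⟨{
    P := P
    K := K
    r := fun i t => r i t
    P_posSemidef := hpsd
    r_nonneg := fun i t => (r i t).2
    P_last := hR.1
    r_last := fun i => by rw [hr0]
    fixed := hfix
    unique := fun t x d hd i => congrFun (G.responseMean_fixed_unique hB hτ t
      (fun j => hpsd j t.succ) (fun j => hbd j t.succ) x hd fun j => hfix j t x) i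
    value := fun i t x => by rw [hr1]; exact hf i t (r i t.succ) x }⟩

namespace BellmanSolution

variable {G} (E : G.BellmanSolution)

/-- The value function of agent `i`. -/
def val (i : Fin N) (t : Fin (T + 1)) : State m → ℝ≥0∞ := quadCost (E.P i t) (E.r i t)

/-- The equilibrium action law of agent `i` in the state `x`. -/
def law (i : Fin N) (t : Fin T) (x : State m) : Measure (Act p) :=
  multivariateGaussian ((E.K i t).toEuclideanLin x) (G.responseCov i t (E.P i t.succ))

instance (i : Fin N) (t : Fin T) (x : State m) : IsProbabilityMeasure (E.law i t x) := by
  unfold law; infer_instance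

/-- The equilibrium profile. -/
def profile : Profile N m p T := fun i =>
  Policy.gaussian (E.K i) fun t => G.responseCov i t (E.P i t.succ)

theorem actionLaw_profile (i : Fin N) (t : Fin T) (ω : Traj N m p T) :
    E.profile.actionLaw i t ω = E.law i t (ω.x t.castSucc) := rfl

theorem isLinearGaussian_profile : E.profile.IsLinearGaussian :=
  ⟨E.K, fun i t => G.responseCov i t (E.P i t.succ),
    fun i t => G.posDef_responseCov i t (E.P_posSemidef i _), fun _ _ _ => rfl⟩

theorem response_law (i : Fin N) (t : Fin T) (x : State m) :
    G.response i t (E.P i t.succ) x (fun j => E.law j t x) = E.law i t x := by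
  simp only [response, law, integral_id_multivariateGaussian]
  rw [E.fixed i t x]

theorem stageValue_law (i : Fin N) (t : Fin T) (x : State m) :
    G.stageValue i t (E.val i t.succ) x (fun j => E.law j t x) = E.val i t.castSucc x :=
  E.value i t x

/-- If the equilibrium laws are played from time `t` on, as long as the state stays in an invariant
family of sets, then the cost-to-go is the value function there. -/
theorem costToGo_eq_val {L : Fin (T + 1) → Set (State m)} (hL : G.Invariant L)
    (π : Profile N m p T) (t : Fin (T + 1))
    (h : ∀ s : Fin T, t ≤ s.castSucc → ∀ j ω, ω.x s.castSucc ∈ L s.castSucc →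
      π.actionLaw j s ω = E.law j s (ω.x s.castSucc))
    (i : Fin N) (ω : Traj N m p T) (hω : ω.x t ∈ L t) :
    G.costToGo π i t ω = E.val i t (ω.x t) := by
  induction t using Fin.reverseInduction generalizing ω with
  | last => rw [costToGo_last, val, E.P_last, E.r_last]
  | cast t ih =>
    have ih' := ih fun s hs => h s (Fin.castSucc_lt_succ.le.trans hs)
    rw [G.costToGo_eq_stageValue π i t ω (V := E.val i t.succ), ← stageValue_law]
    · congr 1
      ext1 j
      exact h t le_rfl j ω hω
    · intro a
      filter_upwards [hL t _ hω a] with w hw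
      rw [ih' _ (by rwa [Traj.extend_x_succ]), Traj.extend_x_succ]

theorem memLp_law (i : Fin N) (t : Fin T) (x : State m) : MemLp id 2 (E.law i t x) :=
  IsGaussian.memLp_two_id (μ := multivariateGaussian _ _)

/-- Against the equilibrium profile, no policy does better than the value function. -/
theorem val_le_costToGo (i : Fin N) (σ : Policy m p T) (t : Fin (T + 1)) (ω : Traj N m p T) :
    E.val i t (ω.x t) ≤ G.costToGo (Function.update E.profile i σ) i t ω := by
  induction t using Fin.reverseInduction generalizing ω with
  | last => rw [costToGo_last, val, E.P_last, E.r_last]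
  | cast t ih =>
    refine le_trans ?_ (G.stageValue_le_costToGo _ i t ω (V := E.val i t.succ) fun a w => ?_)
    · have := σ.isMarkov t
      rw [Profile.actionLaw_update, ← stageValue_law]
      have h := (G.stageValue_response i t (E.P_posSemidef i t.succ) (E.r_nonneg i t.succ)
        (ω.x t.castSucc) (fun j => E.law j t (ω.x t.castSucc)) (fun j => E.memLp_law j t _)
        (σ.kernel t (ω.info i t))).2.1
      rw [response_law, Function.update_eq_self] at h
      exact h
    · have := ih (ω.extend t a (G.step t (ω.x t.castSucc) a w))
      rwa [Traj.extend_x_succ] at this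

theorem isFeedbackNash_profile : G.IsFeedbackNash E.profile := by
  have h : ∀ i t ω, G.costToGo E.profile i t ω = E.val i t (ω.x t) := fun i t ω =>
    E.costToGo_eq_val G.invariant_univ E.profile t (fun _ _ _ _ _ => rfl) i ω (Set.mem_univ _)
  refine ⟨fun i t ω => ?_, fun i t ω σ => ?_⟩
  · rw [h]; exact quadCost_ne_top _ _ _
  · rw [h]; exact E.val_le_costToGo i σ t ω

theorem _root_.LQGame.IsFeedbackNash.isNash {π : Profile N m p T} (h : G.IsFeedbackNash π) :
    G.IsNash π := fun _ i σ => h.2 i 0 _ σ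

/-- Action laws of finite cost that are no worse than the best responses to each other are the
equilibrium laws. -/
theorem eq_law_of_stageValue_le (t : Fin T) (x : State m) (μ : Fin N → Measure (Act p))
    [∀ j, IsProbabilityMeasure (μ j)]
    (hfin : ∀ i, G.stageValue i t (E.val i t.succ) x μ ≠ ∞)
    (hle : ∀ i, G.stageValue i t (E.val i t.succ) x μ ≤ G.stageValue i t (E.val i t.succ) x
      (Function.update μ i (G.response i t (E.P i t.succ) x μ))) (i : Fin N) :
    μ i = E.law i t x := by
  have hμ : ∀ j, MemLp id 2 (μ j) := by
    intro j
    refine memLp_two_of_lintegral_quadForm_ne_top (G.R_posDef j t) fun h => hfin j ?_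
    simp [stageValue, h]
  have hresp : ∀ j, μ j = G.response j t (E.P j t.succ) x μ := by
    intro j
    refine (G.stageValue_response j t (E.P_posSemidef j t.succ) (E.r_nonneg j t.succ) x μ hμ
      (μ j)).2.2 ?_
    rw [Function.update_eq_self]
    exact hle j
  have hmean := E.unique t x (fun j => ∫ u, u ∂(μ j)) fun j => by
    conv_lhs => rw [hresp j]
    rw [response, integral_id_multivariateGaussian]
  rw [hresp i, response, law]
  congr 1
  rw [E.fixed i t x]
  congr 1
  ext1 j
  exact hmean j

/-- The feedback Nash equilibrium is unique. -/
theorem eq_profile_of_isFeedbackNash {π : Profile N m p T} (hπ : G.IsFeedbackNash π) :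
    π = E.profile := by
  suffices h : ∀ t : Fin (T + 1), ∀ s : Fin T, t ≤ s.castSucc → ∀ j ω,
      π.actionLaw j s ω = E.law j s (ω.x s.castSucc) from
    Profile.ext_actionLaw fun i t ω => h 0 t (Fin.zero_le _) i ω
  intro t
  induction t using Fin.reverseInduction with
  | last => exact fun s hs => absurd (Fin.castSucc_lt_last s) (not_lt.2 hs)
  | cast t ih =>
    intro s hs
    rcases hs.eq_or_lt with heq | hlt
    · obtain rfl : t = s := Fin.castSucc_injective _ heq
      intro j ω
      have hcost : ∀ i, G.costToGo π i t.castSucc ω = G.stageValue i t (E.val i t.succ)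
          (ω.x t.castSucc) fun j => π.actionLaw j t ω := fun i =>
        G.costToGo_eq_stageValue π i t ω fun a => ae_of_all _ fun w => by
          rw [E.costToGo_eq_val G.invariant_univ π t.succ (fun s hs j ω _ => ih s hs j ω) i _
            (Set.mem_univ _), Traj.extend_x_succ]
      refine E.eq_law_of_stageValue_le t (ω.x t.castSucc) (fun j => π.actionLaw j t ω)
        (fun i => hcost i ▸ hπ.1 i _ ω) (fun i => ?_) j
      rw [← hcost i]
      -- deviate once, at time `t`, to the best response in the given history
      set ρ := G.response i t (E.P i t.succ) (ω.x t.castSucc) fun j => π.actionLaw j t ω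
      refine (hπ.2 i _ ω ((π i).replaceAt t (Kernel.const _ ρ))).trans (le_of_eq ?_)
      rw [G.costToGo_eq_stageValue _ i t ω (V := E.val i t.succ), Profile.actionLaw_update,
        Policy.replaceAt_kernel_self, Kernel.const_apply]
      refine fun a => ae_of_all _ fun w => ?_
      rw [E.costToGo_eq_val G.invariant_univ _ t.succ (fun s hs j ω _ => ?_) i _ (Set.mem_univ _),
        Traj.extend_x_succ]
      rw [Profile.actionLaw_update_replaceAt_of_ne _ _ (Fin.succ_le_castSucc_iff.1 hs).ne']
      exact ih s hs j ω
    · exact ih s (Fin.castSucc_lt_iff_succ_le.1 hlt)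

end BellmanSolution

/-! ### Reachable states -/

open scoped MatrixOrder in
/-- The square root of the noise covariance, which maps standard Gaussian noise to the noise of the
game. -/
def noise : State m →L[ℝ] State m := Matrix.toEuclideanCLM (𝕜 := ℝ) (CFC.sqrt G.W)

theorem map_noise : (stdGaussian (State m)).map G.noise = multivariateGaussian 0 G.W := by
  rw [multivariateGaussian]
  simp only [zero_add]
  rfl

/-- The states that can be reached from some initial state by some choice of the actions and some
noise in the range of the covariance. -/
inductive Reachable : Fin (T + 1) → State m → Prop
  | start (x : State m) : Reachable 0 x
  | step (t : Fin T) (x : State m) (a : Fin N → Act p) (z : State m) :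
      Reachable t.castSucc x → Reachable t.succ (G.step t x a (G.noise z))

theorem invariant_reachable : G.Invariant fun t => {x | G.Reachable t x} := by
  intro t x hx a
  rw [← G.map_noise]
  have h : ∀ᵐ w ∂((stdGaussian (State m)).map G.noise), w ∈ Set.range G.noise := by
    have hc : IsClosed (Set.range G.noise) := G.noise.range.closed_of_finiteDimensional
    exact (ae_map_iff (by fun_prop) hc.measurableSet).2 (ae_of_all _ fun z => ⟨z, rfl⟩)
  filter_upwards [h] with w hw
  obtain ⟨z, rfl⟩ := hw
  exact Reachable.step t x a z hx

/-- When all action laws have full support, two continuous functions of the next state, one of which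
dominates the other along reachable states, agree there as soon as they have the same finite
mean. -/
theorem eq_on_step_of_lintegral_eq (t : Fin T) (x : State m) (μ : Fin N → Measure (Act p))
    [∀ j, IsProbabilityMeasure (μ j)] [∀ j, (μ j).IsOpenPosMeasure] {f g : State m → ℝ≥0∞}
    (hf : Continuous f) (hg : Continuous g)
    (hle : ∀ a z, f (G.step t x a (G.noise z)) ≤ g (G.step t x a (G.noise z)))
    (hfin : ∫⁻ a, ∫⁻ w, f (G.step t x a w) ∂(multivariateGaussian 0 G.W) ∂(Measure.pi μ) ≠ ∞)
    (heq : ∫⁻ a, ∫⁻ w, g (G.step t x a w) ∂(multivariateGaussian 0 G.W) ∂(Measure.pi μ)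
      = ∫⁻ a, ∫⁻ w, f (G.step t x a w) ∂(multivariateGaussian 0 G.W) ∂(Measure.pi μ))
    (a : Fin N → Act p) (z : State m) :
    f (G.step t x a (G.noise z)) = g (G.step t x a (G.noise z)) := by
  have hB : ∀ j, Continuous (G.B j t).toEuclideanLin := fun j =>
    LinearMap.continuous_of_finiteDimensional _
  have hs : Continuous fun y : (Fin N → Act p) × State m => G.step t x y.1 (G.noise y.2) := by
    unfold step; fun_prop
  have hs' : ∀ a : Fin N → Act p, Continuous fun w : State m => G.step t x a w := by
    intro a; unfold step; fun_prop
  have hconv : ∀ h : State m → ℝ≥0∞, Continuous h →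
      ∫⁻ a, ∫⁻ w, h (G.step t x a w) ∂(multivariateGaussian 0 G.W) ∂(Measure.pi μ)
        = ∫⁻ y, h (G.step t x y.1 (G.noise y.2))
          ∂((Measure.pi μ).prod (stdGaussian (State m))) := by
    intro h hh
    refine Eq.trans (lintegral_congr fun a => ?_)
      (lintegral_prod _ (hh.comp hs).measurable.aemeasurable).symm
    rw [← G.map_noise]
    exact lintegral_map (hh.comp (hs' a)).measurable G.noise.measurable
  have hpos : (stdGaussian (State m)).IsOpenPosMeasure := by
    rw [← multivariateGaussian_zero_one]
    exact isOpenPosMeasure_multivariateGaussian 0 Matrix.PosDef.one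
  have hpi : (Measure.pi μ).IsOpenPosMeasure := Measure.pi.isOpenPosMeasure μ
  have hprod : ((Measure.pi μ).prod (stdGaussian (State m))).IsOpenPosMeasure :=
    Measure.prod.instIsOpenPosMeasure
  rw [hconv f hf] at hfin heq
  rw [hconv g hg] at heq
  have hae := ae_eq_of_ae_le_of_lintegral_le
    (ae_of_all ((Measure.pi μ).prod (stdGaussian (State m))) fun y => hle y.1 y.2) hfin
    (hg.comp hs).measurable.aemeasurable heq.le
  exact congrFun ((Continuous.ae_eq_iff_eq _ (hf.comp hs) (hg.comp hs)).1 hae) (a, z)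

/-! ### Linear Gaussian Nash equilibria -/

/-- Suppose that two linear Gaussian profiles have the same action laws before time `t`, and that
the second one costs agent `i` no more at time `t` in reachable states. If it costs agent `i`
no less at time `0`, then both cost the same in the states that are reachable at time `t`. -/
theorem costToGo_eq_of_le_at_zero {π ρ : Profile N m p T} (hπ : π.IsLinearGaussian)
    (hρ : ρ.IsLinearGaussian) (i : Fin N) (t : Fin (T + 1))
    (hlaw : ∀ s : Fin T, s.castSucc < t → ∀ j ω, ρ.actionLaw j s ω = π.actionLaw j s ω)
    (hle : ∀ ω, G.Reachable t (ω.x t) → G.costToGo ρ i t ω ≤ G.costToGo π i t ω)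
    (h0 : ∀ x₀, G.cost π i x₀ ≤ G.cost ρ i x₀) (ω : Traj N m p T)
    (hω : G.Reachable t (ω.x t)) : G.costToGo π i t ω = G.costToGo ρ i t ω := by
  obtain ⟨K₁, S₁, hS₁, hπ⟩ := hπ
  obtain ⟨K₂, S₂, hS₂, hρ⟩ := hρ
  choose P₁ r₁ _ _ hc₁ using G.exists_costToGo_eq_quadCost hS₁ hπ i
  choose P₂ r₂ _ _ hc₂ using G.exists_costToGo_eq_quadCost hS₂ hρ i
  -- the comparison at time `t` propagates to earlier times
  have hle' : ∀ s : Fin (T + 1), s ≤ t → ∀ ω, G.Reachable s (ω.x s) →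
      G.costToGo ρ i s ω ≤ G.costToGo π i s ω := by
    intro s
    induction s using Fin.reverseInduction with
    | last => exact fun hs => (le_antisymm hs (Fin.le_last t)) ▸ hle
    | cast s ih =>
      intro hs ω hω
      rcases hs.eq_or_lt with heq | hlt
      · exact heq ▸ hle ω (heq ▸ hω)
      · rw [costToGo_castSucc, costToGo_castSucc]
        simp only [hlaw s hlt]
        refine add_le_add le_rfl (lintegral_mono fun a => lintegral_mono_ae ?_)
        filter_upwards [G.invariant_reachable s _ hω a] with w hw
        exact ih (Fin.castSucc_lt_iff_succ_le.1 hlt) _ (by rwa [Traj.extend_x_succ])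
  -- the equality at time `0` propagates to later times
  have heq : ∀ s x, G.Reachable s x → s ≤ t →
      quadCost (P₁ s) (r₁ s) x = quadCost (P₂ s) (r₂ s) x := by
    intro s x hx
    induction hx with
    | start x =>
      intro _
      have h1 := h0 x
      have h2 := hle' 0 (Fin.zero_le _) (Traj.start x) (Reachable.start _)
      rw [hc₁, hc₂] at h2
      rw [cost, cost, hc₁, hc₂] at h1
      exact le_antisymm h1 h2
    | step s x a z hx ih =>
      intro hs
      have hst : s.castSucc < t := Fin.castSucc_lt_iff_succ_le.2 hs
      have hxs : (Traj.start x : Traj N m p T).x s.castSucc = x := rfl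
      have h1 := ih hst.le
      rw [← hxs, ← hc₁, ← hc₂, costToGo_castSucc, costToGo_castSucc] at h1
      simp only [hlaw s hst, hc₁, hc₂, Traj.extend_x_succ, hxs] at h1
      have hfin := quadCost_ne_top (P₁ s.castSucc) (r₁ s.castSucc) x
      rw [ih hst.le, ← hxs, ← hc₂, costToGo_castSucc] at hfin
      simp only [hlaw s hst, hc₂, Traj.extend_x_succ, hxs] at hfin
      obtain ⟨hfin₁, hfin₂⟩ := ENNReal.add_ne_top.1 hfin
      have hpos : ∀ j, (π.actionLaw j s (Traj.start x)).IsOpenPosMeasure := fun j => by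
        rw [hπ]; exact isOpenPosMeasure_multivariateGaussian _ (hS₁ j s)
      refine (G.eq_on_step_of_lintegral_eq s x (fun j => π.actionLaw j s (Traj.start x))
        (continuous_quadCost (P₂ s.succ) (r₂ s.succ)) (continuous_quadCost (P₁ s.succ) (r₁ s.succ))
        (fun a z => ?_) hfin₂ ((ENNReal.add_right_inj hfin₁).1 h1) a z).symm
      have h2 := hle' s.succ hs ((Traj.start x).extend s a (G.step s x a (G.noise z)))
        (by rw [Traj.extend_x_succ]; exact Reachable.step s x a z hx)
      rwa [hc₁, hc₂, Traj.extend_x_succ] at h2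
  rw [hc₁, hc₂]
  exact heq t _ hω le_rfl

namespace BellmanSolution

variable {G} (E : G.BellmanSolution)

/-- A linear Gaussian Nash equilibrium plays the equilibrium laws in all reachable states. -/
theorem actionLaw_eq_law_of_isNash {π : Profile N m p T} (hπ : G.IsNash π)
    (hlin : π.IsLinearGaussian) (s : Fin T) (j : Fin N) (ω : Traj N m p T)
    (hω : G.Reachable s.castSucc (ω.x s.castSucc)) :
    π.actionLaw j s ω = E.law j s (ω.x s.castSucc) := by
  suffices h : ∀ t : Fin (T + 1), ∀ s : Fin T, t ≤ s.castSucc → ∀ j ω,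
      G.Reachable s.castSucc (ω.x s.castSucc) →
      π.actionLaw j s ω = E.law j s (ω.x s.castSucc) from h 0 s (Fin.zero_le _) j ω hω
  clear hω ω j s
  intro t
  induction t using Fin.reverseInduction with
  | last => exact fun s hs => absurd (Fin.castSucc_lt_last s) (not_lt.2 hs)
  | cast t ih =>
    intro s hs
    rcases hs.eq_or_lt with heq | hlt
    swap
    · exact ih s (Fin.castSucc_lt_iff_succ_le.1 hlt)
    obtain rfl : t = s := Fin.castSucc_injective _ heq
    intro j ω hω
    obtain ⟨K, S, hS, hact⟩ := id hlin
    have hcost : ∀ i ω, G.Reachable t.castSucc (ω.x t.castSucc) → G.costToGo π i t.castSucc ω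
        = G.stageValue i t (E.val i t.succ) (ω.x t.castSucc) fun j => π.actionLaw j t ω := by
      intro i ω hω
      refine G.costToGo_eq_stageValue π i t ω fun a => ?_
      filter_upwards [G.invariant_reachable t _ hω a] with w hw
      rw [E.costToGo_eq_val G.invariant_reachable π t.succ ih i _
        (by rwa [Set.mem_ofPred_eq, Traj.extend_x_succ]), Traj.extend_x_succ]
    refine E.eq_law_of_stageValue_le t (ω.x t.castSucc) (fun j => π.actionLaw j t ω)
      (fun i => ?_) (fun i => ?_) j
    · obtain ⟨P, r, -, -, h⟩ := G.exists_costToGo_eq_quadCost hS hact i t.castSucc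
      rw [← hcost i ω hω, h]
      exact quadCost_ne_top _ _ _
    -- deviate once, at time `t`, to the best response, which is linear Gaussian
    set P := E.P i t.succ
    let F : Matrix (Fin p) (Fin m) ℝ := -((G.gainMatrix i t P)⁻¹ * ((G.B i t)ᵀ * P)
      * (G.A t + ∑ j ∈ Finset.univ.erase i, G.B j t * K j t))
    have hF : ∀ x, F.toEuclideanLin x
        = G.responseMean i t P x fun j => (K j t).toEuclideanLin x := by
      intro x
      rw [responseMean, othersDrift, ← toEuclideanLin_closedLoop, map_neg, LinearMap.neg_apply]
      simp only [Matrix.toLpLin_apply, Matrix.mulVec_mulVec]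
    let κ := Policy.gaussianKernel (T := T) (m := m) t F (G.responseCov i t P)
    have hκ : ∀ ω : Traj N m p T, κ (ω.info i t)
        = G.response i t P (ω.x t.castSucc) fun j => π.actionLaw j t ω := by
      intro ω
      rw [Policy.gaussianKernel_apply, response]
      simp only [hact, integral_id_multivariateGaussian]
      exact congrArg (fun d => multivariateGaussian d _) (hF (ω.x t.castSucc))
    let ρ : Profile N m p T := Function.update π i ((π i).replaceAt t κ)
    have hρt : ∀ ω, (fun j => ρ.actionLaw j t ω) = Function.update (fun j => π.actionLaw j t ω) i
        (G.response i t P (ω.x t.castSucc) fun j => π.actionLaw j t ω) := by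
      intro ω
      rw [Profile.actionLaw_update, Policy.replaceAt_kernel_self, hκ]
    have hρs : ∀ s, s ≠ t → ∀ j ω, ρ.actionLaw j s ω = π.actionLaw j s ω := fun s hs j ω =>
      Profile.actionLaw_update_replaceAt_of_ne π i hs κ j ω
    have hρlin : ρ.IsLinearGaussian := by
      refine ⟨fun j s => if s = t ∧ j = i then F else K j s,
        fun j s => if s = t ∧ j = i then G.responseCov i t P else S j s, fun j s => ?_,
        fun j s ω => ?_⟩
      · dsimp only
        split_ifs
        exacts [G.posDef_responseCov i t (E.P_posSemidef i _), hS j s]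
      · by_cases hs : s = t
        · subst hs
          have h1 := congrFun (hρt ω) j
          by_cases hj : j = i
          · subst hj
            rw [Function.update_self, ← hκ] at h1
            simp only [and_self, if_true]
            exact h1
          · rw [Function.update_of_ne hj] at h1
            simp only [hj, and_false, if_false]
            exact h1.trans (hact j s ω)
        · simp only [hs, false_and, if_false]
          rw [hρs s hs, hact]
    have hcostρ : ∀ ω, G.Reachable t.castSucc (ω.x t.castSucc) → G.costToGo ρ i t.castSucc ω
        = G.stageValue i t (E.val i t.succ) (ω.x t.castSucc) (Function.update
          (fun j => π.actionLaw j t ω) i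
          (G.response i t P (ω.x t.castSucc) fun j => π.actionLaw j t ω)) := by
      intro ω hω
      rw [← hρt]
      refine G.costToGo_eq_stageValue ρ i t ω fun a => ?_
      filter_upwards [G.invariant_reachable t _ hω a] with w hw
      rw [E.costToGo_eq_val G.invariant_reachable ρ t.succ (fun s hs j ω hω => ?_) i _
        (by rwa [Set.mem_ofPred_eq, Traj.extend_x_succ]), Traj.extend_x_succ]
      rw [hρs s (Fin.succ_le_castSucc_iff.1 hs).ne']
      exact ih s hs j ω hω
    rw [← hcost i ω hω, ← hcostρ ω hω]
    refine (G.costToGo_eq_of_le_at_zero hlin hρlin i t.castSucc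
      (fun s hs => hρs s (Fin.castSucc_lt_castSucc_iff.1 hs).ne) (fun ω hω => ?_)
      (fun x₀ => hπ x₀ i _) ω hω).le
    rw [hcost i ω hω, hcostρ ω hω]
    have h := (G.stageValue_response i t (E.P_posSemidef i t.succ) (E.r_nonneg i t.succ)
      (ω.x t.castSucc) (fun j => π.actionLaw j t ω) (fun j => by
        simp only [hact]; exact IsGaussian.memLp_two_id) (π.actionLaw i t ω)).2.1
    rwa [Function.update_eq_self] at h

end BellmanSolution

/-- A property that holds along all reachable trajectories holds almost surely. -/
theorem almostSurely_of_reachable (π : Profile N m p T) (x₀ : State m) {E : Traj N m p T → Prop}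
    (hE : ∀ ω, (∀ t, G.Reachable t (ω.x t)) → E ω) : G.AlmostSurely π x₀ E := by
  suffices h : ∀ (t : Fin (T + 1)) (ω : Traj N m p T), (∀ s, s ≤ t → G.Reachable s (ω.x s)) →
      G.expect π (Set.indicator {ω | ¬ E ω} 1) t ω = 0 by
    refine h 0 _ fun s hs => ?_
    rw [Fin.le_zero_iff.1 hs]
    exact Reachable.start _
  intro t
  induction t using Fin.reverseInduction with
  | last =>
    intro ω hω
    rw [expect_last]
    exact Set.indicator_of_notMem (not_not.2 (hE ω fun s => hω s (Fin.le_last s))) _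
  | cast t ih =>
    intro ω hω
    rw [expect_castSucc]
    have h : ∀ a, ∫⁻ w, G.expect π (Set.indicator {ω | ¬ E ω} 1) t.succ
        (ω.extend t a (G.step t (ω.x t.castSucc) a w)) ∂(multivariateGaussian 0 G.W) = 0 := by
      intro a
      rw [← lintegral_zero (μ := multivariateGaussian (0 : State m) G.W)]
      refine lintegral_congr_ae ?_
      filter_upwards [G.invariant_reachable t _ (hω _ le_rfl) a] with w hw
      refine ih _ fun s hs => ?_
      rcases hs.eq_or_lt with rfl | hlt
      · rwa [Traj.extend_x_succ]
      · rw [Traj.extend_x_of_ne _ _ _ _ hlt.ne]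
        exact hω s (Fin.le_castSucc_iff.2 hlt)
    simp only [h, lintegral_zero]

end LQGame

end

theorem mainTheorem2 {N m p T : ℕ} (G : LQGame N m p T) (γB γP : ℝ)
    (hB : ∀ i t, ‖G.B i t‖ ≤ γB)
    (hP : ∀ t₀ P K, G.IsNashRiccati t₀ P K → ∀ i t, t₀ ≤ t → ‖P i t‖ ≤ γP)
    (hτ : 2 * γB ^ 2 * γP * ((N : ℝ) - 1) < G.τ) :
    ∃ π : Profile N m p T,
      G.IsFeedbackNash π ∧ G.IsNash π ∧ π.IsLinearGaussian ∧
      (∀ π' : Profile N m p T, G.IsFeedbackNash π' → π' = π) ∧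
      (∀ π' : Profile N m p T, G.IsNash π' → π'.IsLinearGaussian →
        ∀ x₀, G.AlmostSurely π' x₀ fun ω => ∀ i t, π'.actionLaw i t ω = π.actionLaw i t ω) := by
  obtain ⟨E⟩ := G.nonempty_bellmanSolution hB hP hτ
  refine ⟨E.profile, E.isFeedbackNash_profile, E.isFeedbackNash_profile.isNash,
    E.isLinearGaussian_profile, fun π' h => E.eq_profile_of_isFeedbackNash h,
    fun π' hN hlin x₀ => G.almostSurely_of_reachable π' x₀ fun ω hω i t => ?_⟩
  rw [E.actionLaw_profile]
  exact E.actionLaw_eq_law_of_isNash hN hlin t i ω (hω _)
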